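/- Let $\Omega=[0,2\pi]^2$ with periodic boundary conditions, let $H$ be the space of real, mean-free, divergence-free vector fields in $L^2(\Omega)^2$, with inner product $(u,v)=\int_\Omega u\cdot v\,dx$ and norm $|u|$, and let $V=\{u\in H:\nabla u\in L^2\}$ with norm $\|u\|=\big(\sum_{j=1,2}\int_\Omega|\partial_ju|^2dx\big)^{1/2}$. Let $\mathbb P$ be the Leray projection (the orthogonal projection of $L^2(\Omega)^2$ onto $H$), $A=-\mathbb P\Delta$ the Stokes operator, $B(u,v)=\mathbb P((u\cdot\nabla)v)$, and let $P_N$ be the projection onto Fourier wavenumbers $|k|\le N$ ($N>0$ real). There is a constant $C_L>0$ such that Ladyzhenskaya's inequality $|u|_{L^4}^2\le C_L\|u\|\,|u|$ holds for all $u\in V$; fix any such $C_L$. Let $\nu>0$ and $g_1,g_2\in L^\infty(0,\infty;H)$, and put $$\mathfrak g_j=\frac{\sup_{t\ge0}|g_j(t)|}{\nu^2},\qquad \mathfrak g=(\mathfrak g_1^2+\mathfrak g_2^2)^{1/2}$$ (essential suprema). For $\mu_1,\mu_2>0$ and $N>0$ the mutual nudging intertwinement is the system $$\frac{dv_1}{dt}+\nu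 Av_1+B(v_1,v_1)=g_1+\mu_1(P_Nv_2-P_Nv_1),\qquad \frac{dv_2}{dt}+\nu Av_2+B(v_2,v_2)=g_2+\mu_2(P_Nv_1-P_Nv_2).$$ A (global) strong solution is a pair with $v_1,v_2\in C([0,T];V)\cap L^2(0,T;D(A))$ for every $T>0$ that satisfies the system in $H$ for almost every $t>0$, $v_1,v_2$ being locally absolutely continuous in $H$. The system is called self-synchronous if $|g_1(t)-g_2(t)|\to0$ as $t\to\infty$ implies $|v_1(t)-v_2(t)|\to0$ as $t\to\infty$ for all its strong solutions, whatever the initial data $(v_1(0),v_2(0))\in V\times V$. Let $$N_*=\frac{3\sqrt2}{2}\,C_L^{1/2}\left(\frac{\max\{\mu_1,\mu_2\}}{\min\{\mu_1,\mu_2\}}\right)^{1/2}\mathfrak g .$$ **Theorem.** The mutual nudging intertwinement is self-synchronous whenever $\mu_1,\mu_2>0$, $N>0$ satisfy $$N\ge N_*\qquad\text{and}\qquad \tfrac43N_*^2\nu\le\mu_1+\mu_2\le\tfrac43N^2\nu ,$$ and there exist $N,\mu_1,\mu_2>0$ that satisfy these conditions; in particular there is a choice of $N$ and $\mu_1,\mu_2$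 for which it is self-synchronous. -/

import Mathlib

open MeasureTheory Filter Topology Set

namespace NSE

noncomputable section

/-! ## Periodic vector fields on `Ω = [0, 2π]²` -/

instance two_pi_pos_fact : Fact (0 < 2 * Real.pi) := ⟨Real.two_pi_pos⟩

/-- The periodic box `Ω = (ℝ / 2πℤ)²`, with Lebesgue measure (of total mass `4π²`). -/
abbrev Torus : Type := Fin 2 → AddCircle (2 * Real.pi)

/-- Real square-integrable `2π`-periodic vector fields. The Hilbert-space inner product is
`(u, v) = ∫_Ω u · v dx`, and `‖u‖` is the `L²` norm `|u|`. -/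
abbrev VField : Type := Lp (EuclideanSpace ℝ (Fin 2)) 2 (volume : Measure Torus)

/-- The exponential `e^{i k·x}`. -/
def character (k : Fin 2 → ℤ) : C(Torus, ℂ) where
  toFun x := ∏ i, fourier (k i) (x i)
  continuous_toFun := by fun_prop

/-- The `j`-th component of the Fourier coefficient
`û_k = (2π)⁻² ∫_Ω u(x) e^{-i k·x} dx`. -/
def coeff (u : VField) (k : Fin 2 → ℤ) (j : Fin 2) : ℂ :=
  (((2 * Real.pi) ^ 2 : ℝ) : ℂ)⁻¹ *
    ∫ x : Torus, (starRingEnd ℂ) (character k x) * ((u x j : ℝ) : ℂ)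

/-- The coefficient map as a continuous linear functional (used to see that `H` is closed). -/
def coeffCLM (k : Fin 2 → ℤ) (j : Fin 2) : VField →L[ℝ] ℂ :=
  (((innerSL ℂ (ContinuousMap.toLp 2 (volume : Measure Torus) ℂ (character k))).restrictScalars
    ℝ).comp ((Complex.ofRealCLM.comp (EuclideanSpace.proj (𝕜 := ℝ) j)).compLpL 2 volume))

theorem coeff_eq (u : VField) (k : Fin 2 → ℤ) (j : Fin 2) :
    coeff u k j = (((2 * Real.pi) ^ 2 : ℝ) : ℂ)⁻¹ * coeffCLM k j u := by
  unfold coeff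
  congr 1
  simp only [coeffCLM, ContinuousLinearMap.comp_apply, ContinuousLinearMap.coe_restrictScalars',
    innerSL_apply_apply, L2.inner_def]
  refine integral_congr_ae ?_
  filter_upwards [ContinuousMap.coeFn_toLp (p := 2) (𝕜 := ℂ) (volume : Measure Torus) (character k),
    ContinuousLinearMap.coeFn_compLpL (p := 2) (μ := (volume : Measure Torus))
      (Complex.ofRealCLM.comp (EuclideanSpace.proj (𝕜 := ℝ) j)) u] with x h1 h2
  rw [h1, h2]
  simp [mul_comm]

/-- The space `H` of mean-free, divergence-free fields. Divergence-free in the sense of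
distributions on the torus means `k · û_k = 0` for all `k`; mean-free means `û_0 = 0`. -/
def H : Submodule ℝ VField where
  carrier := {u | (∀ j, coeff u 0 j = 0) ∧ ∀ k, ∑ j, (k j : ℂ) * coeff u k j = 0}
  zero_mem' := by simp [coeff_eq]
  add_mem' := by
    rintro u v ⟨hu, hu'⟩ ⟨hv, hv'⟩
    simp only [coeff_eq, Fin.sum_univ_two] at *
    refine ⟨fun j => ?_, fun k => ?_⟩
    · rw [map_add, mul_add, hu, hv, add_zero]
    · rw [map_add, map_add]
      linear_combination hu' k + hv' k
  smul_mem' := by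
    rintro c u ⟨hu, hu'⟩
    simp only [coeff_eq, Fin.sum_univ_two] at *
    refine ⟨fun j => ?_, fun k => ?_⟩
    · rw [map_smul, Complex.real_smul]
      linear_combination (c : ℂ) * hu j
    · rw [map_smul, map_smul, Complex.real_smul, Complex.real_smul]
      linear_combination (c : ℂ) * hu' k

theorem isClosed_H : IsClosed (H : Set VField) := by
  have h : (H : Set VField) = (⋂ j, {u | coeff u 0 j = 0}) ∩
      ⋂ k : Fin 2 → ℤ, {u | ∑ j, (k j : ℂ) * coeff u k j = 0} := by
    ext u; simp [H]
  rw [h]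
  simp only [coeff_eq]
  refine (isClosed_iInter fun j => ?_).inter (isClosed_iInter fun k => ?_)
  · exact isClosed_eq (by fun_prop) continuous_const
  · exact isClosed_eq (by fun_prop) continuous_const

instance : CompleteSpace H := isClosed_H.completeSpace_coe

/-- The Leray projection: the `L²`-orthogonal projection onto `H`. -/
def leray : VField →L[ℝ] VField := H.starProjection

/-! ## Fourier multipliers: derivatives, the Stokes operator, `P_N` -/

/-- `w` is the field with `ŵ_k = m(k) û_k`. A field is determined by its Fourier coefficients. -/
def IsMultiplier (m : (Fin 2 → ℤ) → ℂ) (u w : VField) : Prop :=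
  ∀ k j, coeff w k j = m k * coeff u k j

/-- `u` lies in the (maximal, `L²`) domain of the Fourier multiplier `m`. -/
def InDomain (m : (Fin 2 → ℤ) → ℂ) (u : VField) : Prop := ∃ w, IsMultiplier m u w

open Classical in
/-- The Fourier multiplier `m` applied to `u` (and `0` outside its domain). -/
def multiplier (m : (Fin 2 → ℤ) → ℂ) (u : VField) : VField :=
  if h : InDomain m u then h.choose else 0

/-- Symbol `i k_j` of `∂_j`. -/
def derivSymbol (j : Fin 2) (k : Fin 2 → ℤ) : ℂ := Complex.I * (k j : ℂ)

/-- The wavenumber `|k|`. -/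
def waveNorm (k : Fin 2 → ℤ) : ℝ := √((k 0 : ℝ) ^ 2 + (k 1 : ℝ) ^ 2)

/-- Symbol `|k|²` of `-Δ`. -/
def stokesSymbol (k : Fin 2 → ℤ) : ℂ := ((waveNorm k ^ 2 : ℝ) : ℂ)

open Classical in
/-- Symbol of the projection onto wavenumbers `|k| ≤ N`. -/
def cutoffSymbol (N : ℝ) (k : Fin 2 → ℤ) : ℂ := if waveNorm k ≤ N then 1 else 0

/-- The weak partial derivative `∂_j u` (of a field with `∂_j u ∈ L²`). -/
def pderiv (j : Fin 2) (u : VField) : VField := multiplier (derivSymbol j) u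

/-- `u ∈ V`: `u ∈ H` with weak derivatives in `L²`. -/
def MemV (u : VField) : Prop := u ∈ H ∧ ∀ j, InDomain (derivSymbol j) u

/-- The norm of `V`: `(∑_j ∫_Ω |∂_j u|² dx)^{1/2}`. -/
def normV (u : VField) : ℝ := √(∑ j, ‖pderiv j u‖ ^ 2)

/-- `u ∈ D(A)`. -/
def MemDA (u : VField) : Prop := u ∈ H ∧ InDomain stokesSymbol u

/-- The Stokes operator `A = -ℙΔ`. -/
def stokes (u : VField) : VField := leray (multiplier stokesSymbol u)

/-- `P_N`, the projection onto Fourier wavenumbers `|k| ≤ N`. -/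
def lowModes (N : ℝ) (u : VField) : VField := multiplier (cutoffSymbol N) u

/-! ## The Navier–Stokes system -/

/-- `(u · ∇) v = ∑_j u_j ∂_j v`, pointwise almost everywhere. -/
def advection (u v : VField) : Torus → EuclideanSpace ℝ (Fin 2) :=
  fun x => ∑ j, (u x j) • (pderiv j v x)

open Classical in
/-- `B(u, v) = ℙ((u · ∇) v)`, for fields with `(u · ∇) v ∈ L²` (such as `u ∈ D(A)`, `v ∈ V`). -/
def B (u v : VField) : VField :=
  if h : MemLp (advection u v) 2 volume then leray (h.toLp (advection u v)) else 0

/-- `f ∈ L^∞(0, ∞; H)`. -/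
structure IsForcing (f : ℝ → VField) : Prop where
  mem_H : ∀ᵐ t ∂(volume.restrict (Ioi (0 : ℝ))), f t ∈ H
  memLp : MemLp f ⊤ (volume.restrict (Ioi (0 : ℝ)))

/-- `v` is a global strong solution of `dv/dt + ν A v + B(v, v) = f`: for every `T > 0`,
`v ∈ C([0,T]; V) ∩ L²(0,T; D(A))`, and the equation holds in `H` for almost every time, in its
integrated form (that is, `v` is locally absolutely continuous in `H`, with this derivative). -/
structure IsStrongSolution (ν : ℝ) (f v : ℝ → VField) : Prop where
  memV : ∀ t, 0 ≤ t → MemV (v t)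
  continuousOn : ContinuousOn v (Ici 0)
  continuousOn_pderiv : ∀ j, ContinuousOn (fun t => pderiv j (v t)) (Ici 0)
  memDA : ∀ᵐ t ∂(volume.restrict (Ioi (0 : ℝ))), MemDA (v t)
  memLp_stokes : ∀ T, 0 < T → MemLp (fun t => stokes (v t)) 2 (volume.restrict (Ioc 0 T))
  integrable : ∀ T, 0 < T →
    IntervalIntegrable (fun s => f s - ν • stokes (v s) - B (v s) (v s)) volume 0 T
  equation : ∀ t, 0 ≤ t →
    v t = v 0 + ∫ s in (0 : ℝ)..t, (f s - ν • stokes (v s) - B (v s) (v s))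

/-! ## The mutual nudging intertwinement -/

/-- `(v₁, v₂)` is a global strong solution of
`dv₁/dt + ν A v₁ + B(v₁, v₁) = g₁ + μ₁ (P_N v₂ - P_N v₁)`,
`dv₂/dt + ν A v₂ + B(v₂, v₂) = g₂ + μ₂ (P_N v₁ - P_N v₂)`. -/
structure IsMutualNudgingSolution (ν μ₁ μ₂ N : ℝ) (g₁ g₂ v₁ v₂ : ℝ → VField) : Prop where
  fst : IsStrongSolution ν (fun t => g₁ t + μ₁ • (lowModes N (v₂ t) - lowModes N (v₁ t))) v₁
  snd : IsStrongSolution ν (fun t => g₂ t + μ₂ • (lowModes N (v₁ t) - lowModes N (v₂ t))) v₂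

/-- The mutual nudging intertwinement with external forces `g₁, g₂` is self-synchronous:
if `|g₁(t) - g₂(t)| → 0` as `t → ∞`, then `|v₁(t) - v₂(t)| → 0` for the strong solutions from all
initial data in `V × V`. As `g₁, g₂` are classes in `L^∞(0, ∞; H)`, the first limit disregards
null sets of times. -/
def IsSelfSynchronous (ν μ₁ μ₂ N : ℝ) (g₁ g₂ : ℝ → VField) : Prop :=
  Tendsto (fun t => ‖g₁ t - g₂ t‖) (atTop ⊓ ae volume) (𝓝 0) →
    ∀ v₁ v₂ : ℝ → VField, IsMutualNudgingSolution ν μ₁ μ₂ N g₁ g₂ v₁ v₂ →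
      Tendsto (fun t => ‖v₁ t - v₂ t‖) atTop (𝓝 0)

/-- `𝔤_j = sup_{t ≥ 0} |g_j(t)| / ν²` (essential supremum). -/
def forcingSize (ν : ℝ) (g : ℝ → VField) : ℝ :=
  (eLpNorm g ⊤ (volume.restrict (Ioi (0 : ℝ)))).toReal / ν ^ 2

/-- `𝔤 = (𝔤₁² + 𝔤₂²)^{1/2}`. -/
def pairSize (ν : ℝ) (g₁ g₂ : ℝ → VField) : ℝ :=
  √(forcingSize ν g₁ ^ 2 + forcingSize ν g₂ ^ 2)

/-- `C` is a constant in Ladyzhenskaya's inequality `|u|_{L⁴}² ≤ C ‖u‖ |u|` on `V`. -/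
def IsLadyzhenskayaConst (C : ℝ) : Prop :=
  0 < C ∧ ∀ u : VField, MemV u →
    eLpNorm u 4 (volume : Measure Torus) ^ 2 ≤ ENNReal.ofReal (C * (normV u * ‖u‖))

/-- `N_* = (3√2/2) C_L^{1/2} (max{μ₁,μ₂} / min{μ₁,μ₂})^{1/2} 𝔤`. -/
def Nstar (C_L ν μ₁ μ₂ : ℝ) (g₁ g₂ : ℝ → VField) : ℝ :=
  3 * √2 / 2 * √C_L * √(max μ₁ μ₂ / min μ₁ μ₂) * pairSize ν g₁ g₂

/-- The conditions on the cut-off `N` and the (positive) nudging parameters. -/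
structure Admissible (C_L ν μ₁ μ₂ N : ℝ) (g₁ g₂ : ℝ → VField) : Prop where
  N_pos : 0 < N
  mu₁_pos : 0 < μ₁
  mu₂_pos : 0 < μ₂
  Nstar_le : Nstar C_L ν μ₁ μ₂ g₁ g₂ ≤ N
  le_mu : 4 / 3 * Nstar C_L ν μ₁ μ₂ g₁ g₂ ^ 2 * ν ≤ μ₁ + μ₂
  mu_le : μ₁ + μ₂ ≤ 4 / 3 * N ^ 2 * ν

end

end NSE

/-! Put w = v₁ - v₂ and μ = μ₁ + μ₂. In the equation for w the two nudging terms add up to -μ P_N w,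
which damps the modes |k| ≤ N. On the remaining modes ‖w‖² ≥ N²|w|², so when μ ≤ (4/3)N²ν viscosity
damps them at a comparable rate. Of the nonlinearity only b(w, v₂, w) survives testing with w, and
Ladyzhenskaya bounds it by C ‖w‖ |w| ‖v₂‖. Absorbing ‖w‖ into the viscous term leaves
(`inner_difference_le`) d/dt |w|² ≤ -(5μ/8 - C²‖v₂‖²/ν) |w|² + (8/μ) |g₁ - g₂|². The rate in
parentheses may be negative at some times; by Grönwall it is enough that its time averages are
eventually bounded below by a positive number (`tendsto_zero_of_integral_le`).

The average of ‖v₂‖² is controlled through the weighted energy μ₂|v₁|² + μ₁|v₂|². With these weights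
the coupling contributes -2μ₁μ₂ (P_N w, w) ≤ 0, so the nudging enters the average of ‖v₁‖² + ‖v₂‖²
only through the ratio ρ = max/min of μ₁, μ₂: it is at most ρν²𝔤², up to a bounded error in the time
integral (`IsMutualNudgingSolution.exists_integral_enstrophy_le`).

The constants need care. The lower bound on μ says 6Cρ𝔤²ν ≤ μ, while the averaged rate calls for
C²ρ𝔤²ν ≤ 3μ/8, with one more power of C. This follows if C ≤ 9/4. Hence Ladyzhenskaya's inequality
is proved with the explicit constant 11/5 < 9/4, and a given C_L is replaced by min(C_L, 11/5),
which only weakens the conditions on N, μ₁, μ₂.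

The analytic support is Fourier series on the torus, the antisymmetry b(u, w, w) = 0 (checked on
trigonometric polynomials, then by density in V), and the energy identity for primitives of
integrable Hilbert-space-valued functions. -/

namespace NSE

noncomputable section

open scoped ComplexConjugate

/-! ## Fourier series on the torus -/

theorem character_apply (k : Fin 2 → ℤ) (x : Torus) :
    character k x = ∏ i, fourier (k i) (x i) := rfl

theorem character_zero : character 0 = 1 := by
  ext x; simp [character_apply]

theorem character_add (k l : Fin 2 → ℤ) (x : Torus) :
    character (k + l) x = character k x * character l x := by
  simp only [character_apply, Pi.add_apply, fourier_add, Finset.prod_mul_distrib]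

theorem character_neg (k : Fin 2 → ℤ) (x : Torus) :
    character (-k) x = conj (character k x) := by
  simp only [character_apply, Pi.neg_apply, fourier_neg, map_prod]

theorem norm_character_apply (k : Fin 2 → ℤ) (x : Torus) : ‖character k x‖ = 1 := by
  simp only [character_apply, fourier_apply, norm_prod, Circle.norm_coe, Finset.prod_const_one]

theorem character_single (i : Fin 2) (x : Torus) :
    character (Pi.single i 1) x = fourier 1 (x i) := by
  fin_cases i <;> simp [character_apply, Fin.prod_univ_two]

theorem integral_fourier (n : ℤ) :
    ∫ x : AddCircle (2 * Real.pi), fourier n x = if n = 0 then ((2 * Real.pi : ℝ) : ℂ) else 0 := by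
  split_ifs with h
  · simp [h, measureReal_def, Real.pi_pos.le]
  -- A suitable translation changes the sign of e^{inx} and preserves the measure.
  · exact integral_eq_zero_of_add_right_eq_neg (μ := volume)
      (fourier_add_half_inv_index h Real.two_pi_pos)

theorem integral_character (k : Fin 2 → ℤ) :
    ∫ x : Torus, character k x = if k = 0 then (((2 * Real.pi) ^ 2 : ℝ) : ℂ) else 0 := by
  simp only [character_apply]
  rw [MeasureTheory.integral_fintype_prod_volume_eq_prod (fun i x => fourier (k i) x)]
  simp only [integral_fourier, Fin.prod_univ_two]
  by_cases h0 : k 0 = 0 <;> by_cases h1 : k 1 = 0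
  · have : k = 0 := by ext i; fin_cases i <;> simpa
    simp [this]; ring
  all_goals
    have : k ≠ 0 := by rintro rfl; simp_all
    simp_all

/-- The exponentials as elements of `L²`. -/
abbrev characterLp (k : Fin 2 → ℤ) : Lp ℂ 2 (volume : Measure Torus) :=
  ContinuousMap.toLp 2 (volume : Measure Torus) ℂ (character k)

theorem inner_characterLp (k l : Fin 2 → ℤ) :
    inner ℂ (characterLp k) (characterLp l) =
      if k = l then (((2 * Real.pi) ^ 2 : ℝ) : ℂ) else 0 := by
  rw [ContinuousMap.inner_toLp]
  have : (fun x => character l x * conj (character k x)) = fun x => character (l - k) x := by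
    ext x; rw [sub_eq_add_neg, character_add, character_neg]
  rw [this, integral_character]
  simp only [sub_eq_zero, eq_comm]

/-- The star subalgebra spanned by the exponentials. -/
def trigSubalgebra : StarSubalgebra ℂ C(Torus, ℂ) where
  toSubalgebra := Algebra.adjoin ℂ (range character)
  star_mem' := by
    change Algebra.adjoin ℂ (range character) ≤ star (Algebra.adjoin ℂ (range character))
    refine Algebra.adjoin_le ?_
    rintro _ ⟨n, rfl⟩
    refine Algebra.subset_adjoin ⟨-n, ?_⟩
    ext1 x
    simp only [character_neg, starRingEnd_apply, ContinuousMap.star_apply]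

theorem trigSubalgebra_coe :
    Subalgebra.toSubmodule trigSubalgebra.toSubalgebra = Submodule.span ℂ (range character) := by
  apply Algebra.adjoin_eq_span_of_subset
  refine .trans (fun x ↦ Submonoid.closure_induction (fun _ ↦ id) ⟨0, character_zero⟩ ?_)
    Submodule.subset_span
  rintro _ _ _ _ ⟨m, rfl⟩ ⟨n, rfl⟩
  exact ⟨m + n, by ext z; simp [character_add]⟩

theorem trigSubalgebra_separatesPoints : trigSubalgebra.SeparatesPoints := by
  intro x y hxy
  rw [Ne, funext_iff, not_forall] at hxy
  obtain ⟨i, hi⟩ := hxy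
  refine ⟨_, ⟨character (Pi.single i 1), Algebra.subset_adjoin ⟨Pi.single i 1, rfl⟩, rfl⟩, ?_⟩
  dsimp only
  rw [character_single, character_single, fourier_one, fourier_one]
  exact fun h => hi (AddCircle.injective_toCircle Real.two_pi_pos.ne' (Circle.coe_injective h))

/-- Stone–Weierstrass. The algebra generated by the exponentials is already their linear span,
because products of exponentials are exponentials. -/
theorem span_character_closure_eq_top :
    (Submodule.span ℂ (range character)).topologicalClosure = ⊤ := by
  rw [← trigSubalgebra_coe]
  exact congr_arg (Subalgebra.toSubmodule <| StarSubalgebra.toSubalgebra ·)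
    (ContinuousMap.starSubalgebra_topologicalClosure_eq_top_of_separatesPoints _
      trigSubalgebra_separatesPoints)

theorem span_characterLp_closure_eq_top :
    (Submodule.span ℂ (range characterLp)).topologicalClosure = ⊤ := by
  simpa only [Submodule.map_span, ContinuousLinearMap.coe_coe, ← range_comp, Function.comp_def] using
    (ContinuousMap.toLp_denseRange ℂ (volume : Measure Torus) ℂ
      (p := 2) (by simp)).topologicalClosure_map_submodule span_character_closure_eq_top

/-- The normalized exponentials. -/
def unitCharacter (k : Fin 2 → ℤ) : Lp ℂ 2 (volume : Measure Torus) :=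
  (((2 * Real.pi : ℝ) : ℂ)⁻¹) • characterLp k

theorem orthonormal_unitCharacter : Orthonormal ℂ unitCharacter := by
  rw [orthonormal_iff_ite]
  intro k l
  have : (Real.pi : ℂ) ≠ 0 := by exact_mod_cast Real.pi_ne_zero
  simp only [unitCharacter, inner_smul_left, inner_smul_right, inner_characterLp]
  split_ifs
  · simp [Complex.conj_ofNat]; field_simp
  · simp

theorem span_unitCharacter_closure_eq_top :
    (Submodule.span ℂ (range unitCharacter)).topologicalClosure = ⊤ := by
  rw [← span_characterLp_closure_eq_top]
  congr 1
  refine le_antisymm (Submodule.span_le.2 ?_) (Submodule.span_le.2 ?_)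
  · rintro _ ⟨k, rfl⟩
    exact Submodule.smul_mem _ _ (Submodule.subset_span ⟨k, rfl⟩)
  · rintro _ ⟨k, rfl⟩
    have := Submodule.smul_mem (Submodule.span ℂ (range unitCharacter))
      ((2 * Real.pi : ℝ) : ℂ) (Submodule.subset_span ⟨k, rfl⟩)
    rwa [unitCharacter, smul_inv_smul₀ (by simp)] at this

/-- The Fourier basis of `L²(Torus; ℂ)`. -/
def torusBasis : HilbertBasis (Fin 2 → ℤ) ℂ (Lp ℂ 2 (volume : Measure Torus)) :=
  HilbertBasis.mk orthonormal_unitCharacter span_unitCharacter_closure_eq_top.ge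

/-- The `j`-th component of a real field, as a complex `L²` function. -/
def component (j : Fin 2) : VField →L[ℝ] Lp ℂ 2 (volume : Measure Torus) :=
  (Complex.ofRealCLM.comp (EuclideanSpace.proj (𝕜 := ℝ) j)).compLpL 2 volume

theorem coeFn_component (j : Fin 2) (u : VField) :
    component j u =ᵐ[volume] fun x => ((u x j : ℝ) : ℂ) := by
  filter_upwards [ContinuousLinearMap.coeFn_compLpL (p := 2) (μ := (volume : Measure Torus))
      (Complex.ofRealCLM.comp (EuclideanSpace.proj (𝕜 := ℝ) j)) u] with x h
  exact h

theorem torusBasis_repr_component (u : VField) (k : Fin 2 → ℤ) (j : Fin 2) :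
    torusBasis.repr (component j u) k = (2 * Real.pi : ℝ) * coeff u k j := by
  have : (Real.pi : ℂ) ≠ 0 := by exact_mod_cast Real.pi_ne_zero
  rw [HilbertBasis.repr_apply_apply, torusBasis, HilbertBasis.coe_mk, unitCharacter,
    inner_smul_left, coeff_eq]
  have h : coeffCLM k j u = inner ℂ (characterLp k) (component j u) := rfl
  rw [h]
  simp [Complex.conj_ofNat]
  field_simp

theorem integral_component_mul (u v : VField) (j : Fin 2) :
    inner ℂ (component j u) (component j v) = ((∫ x, u x j * v x j : ℝ) : ℂ) := by
  rw [L2.inner_def, ← integral_complex_ofReal]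
  refine integral_congr_ae ?_
  filter_upwards [coeFn_component j u, coeFn_component j v] with x h1 h2
  simp [h1, h2, mul_comm]

theorem memLp_apply (u : VField) (j : Fin 2) : MemLp (fun x => u x j) 2 volume :=
  (EuclideanSpace.proj j : EuclideanSpace ℝ (Fin 2) →L[ℝ] ℝ).comp_memLp' (Lp.memLp u)

theorem integrable_apply_mul_apply (u v : VField) (i j : Fin 2) :
    Integrable (fun x => u x i * v x j) volume :=
  (memLp_apply u i).integrable_mul (memLp_apply v j)

theorem inner_eq_sum_integral (u v : VField) :
    inner ℝ u v = ∑ j, ∫ x, u x j * v x j := by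
  rw [L2.inner_def, ← integral_finsetSum _ fun j _ => integrable_apply_mul_apply u v j j]
  refine integral_congr_ae (.of_forall fun x => ?_)
  simp [PiLp.inner_apply, mul_comm]

/-- **Parseval's identity** for real fields. -/
theorem hasSum_inner (u v : VField) :
    HasSum (fun k => (2 * Real.pi) ^ 2 * ∑ j, (conj (coeff u k j) * coeff v k j).re)
      (inner ℝ u v) := by
  rw [inner_eq_sum_integral]
  simp only [Finset.mul_sum]
  refine hasSum_sum fun j _ => ?_
  have h := torusBasis.hasSum_inner_mul_inner (component j u) (component j v)
  rw [integral_component_mul] at h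
  have h2 := Complex.hasSum_re h
  simp only [Complex.ofReal_re] at h2
  convert h2 using 2 with k
  rw [← inner_conj_symm, ← HilbertBasis.repr_apply_apply, ← HilbertBasis.repr_apply_apply,
    torusBasis_repr_component, torusBasis_repr_component]
  simp
  ring

theorem hasSum_norm_sq (u : VField) :
    HasSum (fun k => (2 * Real.pi) ^ 2 * ∑ j, ‖coeff u k j‖ ^ 2) (‖u‖ ^ 2) := by
  rw [← real_inner_self_eq_norm_sq]
  convert hasSum_inner u u using 5 with k j
  rw [mul_comm, Complex.mul_conj, Complex.ofReal_re, Complex.normSq_eq_norm_sq]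

theorem coeff_add (u v : VField) (k j) : coeff (u + v) k j = coeff u k j + coeff v k j := by
  simp only [coeff_eq, map_add, mul_add]

theorem coeff_sub (u v : VField) (k j) : coeff (u - v) k j = coeff u k j - coeff v k j := by
  simp only [coeff_eq, map_sub, mul_sub]

theorem ext_coeff {u v : VField} (h : ∀ k j, coeff u k j = coeff v k j) : u = v := by
  have h1 := hasSum_norm_sq (u - v)
  have h0 : ‖u - v‖ ^ 2 = 0 := h1.unique (by simp [coeff_sub, h])
  rw [← sub_eq_zero, ← norm_eq_zero]
  exact pow_eq_zero_iff two_ne_zero |>.1 h0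

theorem coeff_neg_index (u : VField) (k j) : coeff u (-k) j = conj (coeff u k j) := by
  simp only [coeff, map_mul, ← integral_conj, character_neg]
  simp [Complex.conj_ofNat]

theorem torusBasis_repr (f : Lp ℂ 2 (volume : Measure Torus)) (k : Fin 2 → ℤ) :
    torusBasis.repr f k = ((2 * Real.pi : ℝ) : ℂ)⁻¹ * ∫ x, conj (character k x) * f x := by
  rw [HilbertBasis.repr_apply_apply, torusBasis, HilbertBasis.coe_mk, unitCharacter,
    inner_smul_left, L2.inner_def, ← Complex.ofReal_inv, Complex.conj_ofReal]
  congr 1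
  refine integral_congr_ae ?_
  filter_upwards [ContinuousMap.coeFn_toLp (p := 2) (𝕜 := ℂ) (volume : Measure Torus)
    (character k)] with x hx
  rw [hx]
  exact mul_comm _ _

theorem exists_integral_character_eq (c : (Fin 2 → ℤ) → ℂ) (hs : Summable fun k => ‖c k‖ ^ 2) :
    ∃ f : Lp ℂ 2 (volume : Measure Torus), ∀ k,
      ∫ x, conj (character k x) * f x = (((2 * Real.pi) ^ 2 : ℝ) : ℂ) * c k := by
  have hpi : ((2 * Real.pi : ℝ) : ℂ) ≠ 0 := by exact_mod_cast Real.two_pi_pos.ne'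
  have hm : Memℓp (fun k => ((2 * Real.pi : ℝ) : ℂ) * c k) 2 := by
    refine memℓp_gen ?_
    convert! hs.mul_left (‖((2 * Real.pi : ℝ) : ℂ)‖ ^ 2) using 2 with k
    rw [norm_mul, ENNReal.toReal_ofNat, Real.rpow_ofNat, mul_pow]
  let F : lp (fun _ : Fin 2 → ℤ => ℂ) 2 := ⟨_, hm⟩
  have hF : ∀ k, F k = ((2 * Real.pi : ℝ) : ℂ) * c k := fun k => rfl
  refine ⟨torusBasis.repr.symm F, fun k => ?_⟩
  have h1 := torusBasis_repr (torusBasis.repr.symm F) k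
  rw [LinearIsometryEquiv.apply_symm_apply, hF, eq_inv_mul_iff_mul_eq₀ hpi] at h1
  rw [← h1, Complex.ofReal_pow, sq, mul_assoc]

/-- **Riesz–Fischer** for real fields. -/
theorem exists_coeff_eq (c : (Fin 2 → ℤ) → Fin 2 → ℂ) (hc : ∀ k j, c (-k) j = conj (c k j))
    (hs : ∀ j, Summable fun k => ‖c k j‖ ^ 2) : ∃ u : VField, ∀ k j, coeff u k j = c k j := by
  have hpi : (Real.pi : ℂ) ≠ 0 := by exact_mod_cast Real.pi_ne_zero
  choose f hf using fun j => exists_integral_character_eq (fun k => c k j) (hs j)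
  have hmem : MemLp (fun x => (WithLp.toLp 2 fun j => (f j x).re : EuclideanSpace ℝ (Fin 2))) 2
      (volume : Measure Torus) := by
    rw [memLp_piLp_iff]
    intro j
    exact (Lp.memLp (f j)).re
  refine ⟨hmem.toLp _, fun k j => ?_⟩
  have hint (l : Fin 2 → ℤ) : Integrable (fun x => conj (character l x) * f j x) volume := by
    have h1 : Integrable (f j) volume := (Lp.memLp (f j)).integrable (by norm_num)
    refine h1.bdd_mul (c := 1) (by fun_prop) (.of_forall fun x => ?_)
    rw [RCLike.norm_conj, norm_character_apply]
  -- The real part of `f j` has k-th coefficient (c_k + conj c_{-k})/2, which the symmetry `hc`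
  -- makes equal to c_k.
  have h3 : ∫ x : Torus, conj (character k x) * ((hmem.toLp _ x j : ℝ) : ℂ) =
      ∫ x : Torus, (2 : ℂ)⁻¹ * (conj (character k x) * f j x +
        conj (conj (character (-k) x) * f j x)) := by
    refine integral_congr_ae ?_
    filter_upwards [hmem.coeFn_toLp] with x hx
    rw [hx]
    simp only [character_neg, map_mul, Complex.conj_conj, Complex.re_eq_add_conj]
    ring
  rw [coeff, h3, integral_const_mul, integral_add (hint k), integral_conj, hf, hf, hc]
  · simp [Complex.conj_ofNat]; field_simp; norm_num; ring
  · exact (Complex.conjCLE.toContinuousLinearMap).integrable_comp (hint (-k))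

/-! ## Fourier multipliers -/

theorem InDomain.isMultiplier {m : (Fin 2 → ℤ) → ℂ} {u : VField} (h : InDomain m u) :
    IsMultiplier m u (multiplier m u) := by
  rw [multiplier, dif_pos h]; exact h.choose_spec

theorem IsMultiplier.inDomain {m : (Fin 2 → ℤ) → ℂ} {u w : VField} (h : IsMultiplier m u w) :
    InDomain m u := ⟨w, h⟩

theorem IsMultiplier.multiplier_eq {m : (Fin 2 → ℤ) → ℂ} {u w : VField} (h : IsMultiplier m u w) :
    multiplier m u = w :=
  ext_coeff fun k j => by rw [h.inDomain.isMultiplier k j, h k j]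

theorem IsMultiplier.sub {m : (Fin 2 → ℤ) → ℂ} {u u' w w' : VField} (h : IsMultiplier m u w)
    (h' : IsMultiplier m u' w') : IsMultiplier m (u - u') (w - w') := fun k j => by
  rw [coeff_sub, coeff_sub, h k j, h' k j, mul_sub]

theorem multiplier_sub {m : (Fin 2 → ℤ) → ℂ} {u v : VField} (hu : InDomain m u)
    (hv : InDomain m v) : multiplier m (u - v) = multiplier m u - multiplier m v :=
  (hu.isMultiplier.sub hv.isMultiplier).multiplier_eq

/-- Symbols that preserve real fields. -/
def IsRealSymbol (m : (Fin 2 → ℤ) → ℂ) : Prop := ∀ k, m (-k) = conj (m k)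

theorem waveNorm_neg (k : Fin 2 → ℤ) : waveNorm (-k) = waveNorm k := by simp [waveNorm]

theorem waveNorm_nonneg (k : Fin 2 → ℤ) : 0 ≤ waveNorm k := Real.sqrt_nonneg _

theorem waveNorm_sq (k : Fin 2 → ℤ) : waveNorm k ^ 2 = (k 0 : ℝ) ^ 2 + (k 1 : ℝ) ^ 2 :=
  Real.sq_sqrt (by positivity)

theorem isRealSymbol_deriv (j : Fin 2) : IsRealSymbol (derivSymbol j) := fun k => by
  simp [derivSymbol]

theorem isRealSymbol_cutoff (N : ℝ) : IsRealSymbol (cutoffSymbol N) := fun k => by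
  simp only [cutoffSymbol, waveNorm_neg]; split_ifs <;> simp

theorem norm_derivSymbol_sq (j : Fin 2) (k : Fin 2 → ℤ) : ‖derivSymbol j k‖ ^ 2 = (k j : ℝ) ^ 2 := by
  simp [derivSymbol]

theorem sum_norm_derivSymbol_sq (k : Fin 2 → ℤ) :
    ∑ j, ‖derivSymbol j k‖ ^ 2 = waveNorm k ^ 2 := by
  simp [norm_derivSymbol_sq, waveNorm_sq, Fin.sum_univ_two]

theorem norm_stokesSymbol (k : Fin 2 → ℤ) : ‖stokesSymbol k‖ = waveNorm k ^ 2 := by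
  rw [stokesSymbol, Complex.norm_real, Real.norm_of_nonneg (by positivity)]

theorem one_le_waveNorm {k : Fin 2 → ℤ} (hk : k ≠ 0) : 1 ≤ waveNorm k ^ 2 := by
  rw [waveNorm_sq]
  have : 0 < k 0 ^ 2 + k 1 ^ 2 := by
    by_contra! h
    refine hk (funext fun i => ?_)
    fin_cases i <;> simp <;> nlinarith [sq_nonneg (k 0), sq_nonneg (k 1)]
  exact_mod_cast this

theorem summable_norm_coeff_sq (u : VField) (j : Fin 2) : Summable fun k => ‖coeff u k j‖ ^ 2 := by
  refine Summable.of_nonneg_of_le (fun k => by positivity) (fun k => ?_)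
    ((hasSum_norm_sq u).summable.mul_left (((2 * Real.pi) ^ 2)⁻¹))
  rw [inv_mul_cancel_left₀ (by positivity)]
  exact Finset.single_le_sum (f := fun i => ‖coeff u k i‖ ^ 2) (fun i _ => by positivity)
    (Finset.mem_univ j)

/-- Riesz–Fischer: domination by the coefficients of an actual field gives square summability, and a
real symbol keeps the conjugation symmetry. -/
theorem inDomain_of_le {m : (Fin 2 → ℤ) → ℂ} (hm : IsRealSymbol m) {u w : VField}
    (h : ∀ k j, ‖m k * coeff u k j‖ ≤ ‖coeff w k j‖) : InDomain m u := by
  obtain ⟨v, hv⟩ := exists_coeff_eq (fun k j => m k * coeff u k j)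
    (fun k j => by rw [hm, coeff_neg_index, map_mul])
    (fun j => .of_nonneg_of_le (fun k => by positivity)
      (fun k => pow_le_pow_left₀ (norm_nonneg _) (h k j) 2) (summable_norm_coeff_sq w j))
  exact ⟨v, hv⟩

theorem IsMultiplier.mem_H {m : (Fin 2 → ℤ) → ℂ} {u w : VField} (h : IsMultiplier m u w)
    (hu : u ∈ H) : w ∈ H := by
  refine ⟨fun j => by rw [h 0 j, hu.1 j, mul_zero], fun k => ?_⟩
  simp only [h k]
  rw [← mul_zero (m k), ← hu.2 k, Finset.mul_sum]
  exact Finset.sum_congr rfl fun j _ => by ring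

/-! ### The cut-off -/

theorem inDomain_cutoff (N : ℝ) (u : VField) : InDomain (cutoffSymbol N) u :=
  inDomain_of_le (isRealSymbol_cutoff N) (w := u) fun k j => by
    simp only [cutoffSymbol]; split_ifs <;> simp

theorem isMultiplier_lowModes (N : ℝ) (u : VField) :
    IsMultiplier (cutoffSymbol N) u (lowModes N u) := (inDomain_cutoff N u).isMultiplier

theorem lowModes_sub (N : ℝ) (u v : VField) : lowModes N (u - v) = lowModes N u - lowModes N v :=
  multiplier_sub (inDomain_cutoff N u) (inDomain_cutoff N v)

theorem norm_lowModes_le (N : ℝ) (u : VField) : ‖lowModes N u‖ ≤ ‖u‖ := by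
  refine (pow_le_pow_iff_left₀ (norm_nonneg _) (norm_nonneg _) two_ne_zero).1 ?_
  refine hasSum_le (fun k => ?_) (hasSum_norm_sq (lowModes N u)) (hasSum_norm_sq u)
  simp only [isMultiplier_lowModes N u k, cutoffSymbol]
  gcongr with j
  split_ifs <;> simp

theorem hasSum_inner_lowModes (N : ℝ) (u : VField) :
    HasSum (fun k => if waveNorm k ≤ N then (2 * Real.pi) ^ 2 * ∑ j, ‖coeff u k j‖ ^ 2 else 0)
      (inner ℝ (lowModes N u) u) := by
  convert hasSum_inner (lowModes N u) u using 2 with k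
  simp only [isMultiplier_lowModes N u k, cutoffSymbol]
  split_ifs
  · simp only [one_mul, ← Complex.normSq_eq_conj_mul_self, Complex.ofReal_re,
      Complex.normSq_eq_norm_sq]
  · simp

theorem inner_lowModes_nonneg (N : ℝ) (u : VField) : 0 ≤ inner ℝ (lowModes N u) u :=
  (hasSum_inner_lowModes N u).nonneg fun k => by split_ifs <;> positivity

theorem tendsto_lowModes (u : VField) :
    Tendsto (fun n : ℕ => lowModes n u) atTop (𝓝 u) := by
  rw [tendsto_iff_norm_sub_tendsto_zero]
  have h : Tendsto (fun n : ℕ => ‖lowModes n u - u‖ ^ 2) atTop (𝓝 0) := by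
    have h1 (n : ℕ) := (hasSum_norm_sq (lowModes n u - u)).tsum_eq
    simp only [← h1]
    have h0 : ∑' _ : Fin 2 → ℤ, (0 : ℝ) = 0 := tsum_zero
    rw [← h0]
    refine tendsto_tsum_of_dominated_convergence (hasSum_norm_sq u).summable (fun k => ?_)
      (.of_forall fun n k => ?_)
    · refine tendsto_const_nhds.congr' ?_
      filter_upwards [eventually_ge_atTop ⌈waveNorm k⌉₊] with n hn
      simp only [coeff_sub, isMultiplier_lowModes (n : ℝ) u k, cutoffSymbol]
      rw [if_pos ((Nat.le_ceil _).trans (by exact_mod_cast hn))]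
      simp
    · rw [Real.norm_of_nonneg (by positivity)]
      gcongr with j
      simp only [coeff_sub, isMultiplier_lowModes (n : ℝ) u k, cutoffSymbol]
      split_ifs <;> simp
  simpa [Real.sqrt_sq, Function.comp_def] using (Real.continuous_sqrt.tendsto _).comp h

/-! ### Derivatives -/

theorem MemV.isMultiplier_pderiv {u : VField} (h : MemV u) (j : Fin 2) :
    IsMultiplier (derivSymbol j) u (pderiv j u) := (h.2 j).isMultiplier

theorem MemV.sub {u v : VField} (hu : MemV u) (hv : MemV v) : MemV (u - v) :=
  ⟨H.sub_mem hu.1 hv.1, fun j =>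
    ((hu.isMultiplier_pderiv j).sub (hv.isMultiplier_pderiv j)).inDomain⟩

theorem MemV.pderiv_sub {u v : VField} (hu : MemV u) (hv : MemV v) (j : Fin 2) :
    pderiv j (u - v) = pderiv j u - pderiv j v := multiplier_sub (hu.2 j) (hv.2 j)

theorem normV_sq (u : VField) : normV u ^ 2 = ∑ j, ‖pderiv j u‖ ^ 2 := Real.sq_sqrt (by positivity)

theorem normV_nonneg (u : VField) : 0 ≤ normV u := Real.sqrt_nonneg _

theorem MemV.hasSum_normV_sq {u : VField} (h : MemV u) :
    HasSum (fun k => waveNorm k ^ 2 * ((2 * Real.pi) ^ 2 * ∑ j, ‖coeff u k j‖ ^ 2))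
      (normV u ^ 2) := by
  rw [normV_sq]
  convert hasSum_sum fun i (_ : i ∈ Finset.univ) => hasSum_norm_sq (pderiv i u) using 2 with k
  simp only [h.isMultiplier_pderiv _ k, norm_mul, mul_pow, ← sum_norm_derivSymbol_sq,
    Fin.sum_univ_two]
  ring

/-- **Poincaré's inequality**. -/
theorem MemV.norm_le_normV {u : VField} (h : MemV u) : ‖u‖ ≤ normV u := by
  refine (pow_le_pow_iff_left₀ (norm_nonneg _) (normV_nonneg u) two_ne_zero).1 ?_
  refine hasSum_le (fun k => ?_) (hasSum_norm_sq u) h.hasSum_normV_sq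
  rcases eq_or_ne k 0 with rfl | hk
  · simp [h.1.1]
  · exact le_mul_of_one_le_left (by positivity) (one_le_waveNorm hk)

/-- The bracket is the energy in the modes |k| > N, each of which counts with weight |k|² ≥ N² on
the right. This lets viscosity control the modes that nudging does not reach. -/
theorem MemV.sq_mul_le_normV_sq {u : VField} (h : MemV u) {N : ℝ} (hN : 0 ≤ N) :
    N ^ 2 * (‖u‖ ^ 2 - inner ℝ (lowModes N u) u) ≤ normV u ^ 2 := by
  refine hasSum_le (fun k => ?_) (((hasSum_norm_sq u).sub (hasSum_inner_lowModes N u)).mul_left _)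
    h.hasSum_normV_sq
  split_ifs with hk
  · rw [sub_self, mul_zero]; positivity
  · rw [sub_zero]; gcongr; exact (not_le.1 hk).le

theorem MemV.isMultiplier_pderiv_lowModes {u : VField} (h : MemV u) (N : ℝ) (j : Fin 2) :
    IsMultiplier (derivSymbol j) (lowModes N u) (lowModes N (pderiv j u)) := fun k i => by
  rw [isMultiplier_lowModes N u k, isMultiplier_lowModes N _ k, h.isMultiplier_pderiv j k]
  ring

theorem MemV.lowModes {u : VField} (h : MemV u) (N : ℝ) : MemV (lowModes N u) :=
  ⟨(isMultiplier_lowModes N u).mem_H h.1, fun j => (h.isMultiplier_pderiv_lowModes N j).inDomain⟩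

theorem MemV.pderiv_lowModes {u : VField} (h : MemV u) (N : ℝ) (j : Fin 2) :
    pderiv j (NSE.lowModes N u) = NSE.lowModes N (pderiv j u) :=
  (h.isMultiplier_pderiv_lowModes N j).multiplier_eq

theorem MemV.normV_lowModes_le {u : VField} (h : MemV u) (N : ℝ) :
    normV (NSE.lowModes N u) ≤ normV u := by
  unfold normV
  gcongr with j
  rw [h.pderiv_lowModes]
  exact norm_lowModes_le N _

theorem MemV.tendsto_normV_lowModes_sub {u : VField} (h : MemV u) :
    Tendsto (fun n : ℕ => normV (NSE.lowModes n u - u)) atTop (𝓝 0) := by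
  have h1 : Tendsto (fun n : ℕ => ∑ j, ‖NSE.lowModes n (pderiv j u) - pderiv j u‖ ^ 2) atTop
      (𝓝 0) := by
    rw [← Finset.sum_const_zero (ι := Fin 2) (s := Finset.univ)]
    refine tendsto_finsetSum _ fun j _ => ?_
    simpa using (tendsto_iff_norm_sub_tendsto_zero.1 (tendsto_lowModes (pderiv j u))).pow 2
  have h2 := (Real.continuous_sqrt.tendsto _).comp h1
  rw [Real.sqrt_zero] at h2
  refine h2.congr fun n => ?_
  simp only [Function.comp_apply, normV, (h.lowModes n).pderiv_sub h, h.pderiv_lowModes]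

/-! ### The Stokes operator -/

theorem leray_of_mem_H {u : VField} (h : u ∈ H) : leray u = u :=
  Submodule.starProjection_eq_self_iff.2 h

theorem inner_leray {u w : VField} (hw : w ∈ H) : inner ℝ (leray u) w = inner ℝ u w := by
  conv_rhs => rw [← leray_of_mem_H hw]
  exact Submodule.inner_starProjection_left_eq_right H u w

theorem MemDA.stokes_eq {u : VField} (h : MemDA u) : stokes u = multiplier stokesSymbol u :=
  leray_of_mem_H (h.2.isMultiplier.mem_H h.1)

theorem MemDA.isMultiplier_stokes {u : VField} (h : MemDA u) :
    IsMultiplier stokesSymbol u (stokes u) := h.stokes_eq ▸ h.2.isMultiplier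

theorem MemDA.sub {u v : VField} (hu : MemDA u) (hv : MemDA v) : MemDA (u - v) :=
  ⟨H.sub_mem hu.1 hv.1, (hu.isMultiplier_stokes.sub hv.isMultiplier_stokes).inDomain⟩

theorem MemDA.stokes_sub {u v : VField} (hu : MemDA u) (hv : MemDA v) :
    stokes (u - v) = stokes u - stokes v :=
  ext_coeff fun k j => by
    rw [(hu.sub hv).isMultiplier_stokes k j,
      (hu.isMultiplier_stokes.sub hv.isMultiplier_stokes) k j]

theorem norm_derivSymbol_le (j : Fin 2) (k : Fin 2 → ℤ) : ‖derivSymbol j k‖ ≤ waveNorm k := by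
  refine (pow_le_pow_iff_left₀ (norm_nonneg _) (waveNorm_nonneg k) two_ne_zero).1 ?_
  rw [← sum_norm_derivSymbol_sq]
  exact Finset.single_le_sum (f := fun i => ‖derivSymbol i k‖ ^ 2) (fun i _ => by positivity)
    (Finset.mem_univ j)

theorem MemDA.memV {u : VField} (h : MemDA u) : MemV u := by
  refine ⟨h.1, fun j => inDomain_of_le (isRealSymbol_deriv j) (w := stokes u) fun k i => ?_⟩
  rw [h.isMultiplier_stokes k i, norm_mul, norm_mul, norm_stokesSymbol]
  rcases eq_or_ne k 0 with rfl | hk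
  · simp [h.1.1]
  · have h1 := one_le_waveNorm hk
    have h2 := waveNorm_nonneg k
    gcongr
    exact (norm_derivSymbol_le j k).trans (by nlinarith)

theorem MemDA.memV_pderiv {u : VField} (h : MemDA u) (j : Fin 2) : MemV (pderiv j u) := by
  have hj := h.memV.isMultiplier_pderiv j
  refine ⟨hj.mem_H h.1, fun i => inDomain_of_le (isRealSymbol_deriv i) (w := stokes u) fun k l => ?_⟩
  rw [h.isMultiplier_stokes k l, hj k l, norm_mul, norm_mul, norm_mul, norm_stokesSymbol,
    ← mul_assoc, sq]
  gcongr
  exacts [waveNorm_nonneg k, norm_derivSymbol_le _ _, norm_derivSymbol_le _ _]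

theorem MemDA.inner_stokes {u : VField} (h : MemDA u) : inner ℝ (stokes u) u = normV u ^ 2 := by
  refine (hasSum_inner (stokes u) u).unique ?_
  convert h.memV.hasSum_normV_sq using 2 with k
  simp only [h.isMultiplier_stokes k, stokesSymbol, map_mul, Complex.conj_ofReal, mul_assoc,
    Complex.re_ofReal_mul, ← Finset.mul_sum, Complex.normSq_eq_conj_mul_self.symm,
    Complex.ofReal_re, Complex.normSq_eq_norm_sq]
  ring

/-! ### Trigonometric polynomials -/

theorem finite_waveNorm_le (N : ℝ) : {k : Fin 2 → ℤ | waveNorm k ≤ N}.Finite := by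
  refine (Set.finite_Icc (fun _ => -⌈N⌉) (fun _ => ⌈N⌉)).subset fun k hk => ?_
  have h (i : Fin 2) : |(k i : ℝ)| ≤ ⌈N⌉ := by
    refine le_trans ?_ ((show waveNorm k ≤ N from hk).trans (Int.le_ceil N))
    have := norm_derivSymbol_le i k
    simpa [derivSymbol] using this
  refine ⟨fun i => ?_, fun i => ?_⟩
  · have := neg_le_of_abs_le (h i); exact_mod_cast this
  · have := le_of_abs_le (h i); exact_mod_cast this

/-- The wavenumbers `|k| ≤ N`. -/
def modes (N : ℝ) : Finset (Fin 2 → ℤ) := (finite_waveNorm_le N).toFinset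

theorem mem_modes {N : ℝ} {k : Fin 2 → ℤ} : k ∈ modes N ↔ waveNorm k ≤ N := by simp [modes]

theorem component_lowModes (N : ℝ) (u : VField) (j : Fin 2) :
    component j (lowModes N u) = ∑ k ∈ modes N, coeff u k j • characterLp k := by
  have hpi : ((2 * Real.pi : ℝ) : ℂ) ≠ 0 := by exact_mod_cast Real.two_pi_pos.ne'
  apply torusBasis.repr.injective
  ext l
  rw [torusBasis_repr_component, isMultiplier_lowModes N u l, HilbertBasis.repr_apply_apply,
    torusBasis, HilbertBasis.coe_mk, inner_sum, unitCharacter]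
  simp only [inner_smul_left, inner_smul_right, inner_characterLp, cutoffSymbol]
  simp only [mul_ite, mul_zero, Finset.sum_ite_eq, mem_modes, map_inv₀, Complex.conj_ofReal]
  split_ifs
  · rw [Complex.ofReal_pow]; field_simp
  · simp

theorem lowModes_apply_ae (N : ℝ) (u : VField) (j : Fin 2) :
    ∀ᵐ x, ((lowModes N u x j : ℝ) : ℂ) = ∑ k ∈ modes N, coeff u k j * character k x := by
  have h1 := coeFn_component j (lowModes N u)
  rw [component_lowModes] at h1
  have h2 := Lp.coeFn_finsetSum (modes N) fun k => coeff u k j • characterLp k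
  have h3 : ∀ᵐ x, ∀ k, (coeff u k j • characterLp k) x = coeff u k j * character k x := by
    rw [ae_all_iff]
    intro k
    filter_upwards [Lp.coeFn_smul (coeff u k j) (characterLp k),
      ContinuousMap.coeFn_toLp (p := 2) (𝕜 := ℂ) (volume : Measure Torus) (character k)]
      with x h4 h5
    rw [h4, Pi.smul_apply, h5, smul_eq_mul]
  filter_upwards [h1, h2, h3] with x h1 h2 h3
  rw [← h1, h2, Finset.sum_apply]
  exact Finset.sum_congr rfl fun k _ => h3 k

/-! ## Ladyzhenskaya's inequality -/

section Circle

variable {E : Type*} [NormedAddCommGroup E] [InnerProductSpace ℝ E]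

theorem continuous_integrable {X F : Type*} [TopologicalSpace X] [CompactSpace X] [MeasurableSpace X]
    [OpensMeasurableSpace X] {μ : Measure X} [IsFiniteMeasureOnCompacts μ] [NormedAddCommGroup F]
    {f : X → F} (hf : Continuous f) : Integrable f μ :=
  hf.integrable_of_hasCompactSupport (HasCompactSupport.of_compactSpace f)

/-- Integrate the derivative of ‖f‖² along the arc from y to x, lifted so that it lies within one
period, and enlarge the arc to the whole circle. -/
theorem norm_sq_sub_norm_sq_le {f f' : AddCircle (2 * Real.pi) → E} (hf : Continuous f)
    (hf' : Continuous f') (hd : ∀ s : ℝ, HasDerivAt (fun r : ℝ => f r) (f' s) s)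
    (x y : AddCircle (2 * Real.pi)) :
    ‖f x‖ ^ 2 - ‖f y‖ ^ 2 ≤ 2 * ∫ s, ‖f s‖ * ‖f' s‖ := by
  induction y using QuotientAddGroup.induction_on with | _ b
  obtain ⟨a, ha, rfl⟩ : ∃ a ∈ Ioc b (b + 2 * Real.pi), (a : AddCircle (2 * Real.pi)) = x :=
    ⟨_, (AddCircle.equivIoc (2 * Real.pi) b x).2, (AddCircle.equivIoc (2 * Real.pi) b).left_inv x⟩
  have hq : Continuous fun r : ℝ => (r : AddCircle (2 * Real.pi)) := AddCircle.continuous_mk' _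
  have hF : Continuous fun r : ℝ => f r := hf.comp hq
  have hF' : Continuous fun r : ℝ => f' r := hf'.comp hq
  have h1 : ∫ r in b..a, 2 * inner ℝ (f r) (f' r) = ‖f a‖ ^ 2 - ‖f b‖ ^ 2 :=
    intervalIntegral.integral_eq_sub_of_hasDerivAt (fun r _ => (hd r).norm_sq)
      (((hF.inner hF').const_mul 2).intervalIntegrable _ _)
  have h2 : Continuous fun r : ℝ => ‖f r‖ * ‖f' r‖ := hF.norm.mul hF'.norm
  calc ‖f a‖ ^ 2 - ‖f b‖ ^ 2 = ∫ r in b..a, 2 * inner ℝ (f r) (f' r) := h1.symm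
    _ ≤ ∫ r in b..a, 2 * (‖f r‖ * ‖f' r‖) := by
        refine intervalIntegral.integral_mono ha.1.le
          (((hF.inner hF').const_mul 2).intervalIntegrable _ _)
          ((h2.const_mul 2).intervalIntegrable _ _) fun r => ?_
        gcongr
        exact real_inner_le_norm _ _
    _ = 2 * ∫ r in b..a, ‖f r‖ * ‖f' r‖ := intervalIntegral.integral_const_mul _ _
    _ ≤ 2 * ∫ r in b..(b + 2 * Real.pi), ‖f r‖ * ‖f' r‖ := by
        gcongr
        refine intervalIntegral.integral_mono_interval le_rfl ha.1.le ha.2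
          (.of_forall fun r => by positivity) (h2.intervalIntegrable _ _)
    _ = 2 * ∫ s, ‖f s‖ * ‖f' s‖ := by
        rw [AddCircle.intervalIntegral_preimage (2 * Real.pi) b fun s => ‖f s‖ * ‖f' s‖]

/-- Average `norm_sq_sub_norm_sq_le` over y. -/
theorem norm_sq_le_integral {f f' : AddCircle (2 * Real.pi) → E} (hf : Continuous f)
    (hf' : Continuous f') (hd : ∀ s : ℝ, HasDerivAt (fun r : ℝ => f r) (f' s) s)
    (x : AddCircle (2 * Real.pi)) :
    ‖f x‖ ^ 2 ≤ ∫ s, ((2 * Real.pi)⁻¹ * ‖f s‖ ^ 2 + 2 * (‖f s‖ * ‖f' s‖)) := by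
  have hpi := Real.two_pi_pos
  have h := integral_mono (μ := volume) (integrable_const (‖f x‖ ^ 2))
    (continuous_integrable (by fun_prop))
    (fun y => by linarith [norm_sq_sub_norm_sq_le hf hf' hd x y] :
      (fun _ => ‖f x‖ ^ 2) ≤ fun y => ‖f y‖ ^ 2 + 2 * ∫ s, ‖f s‖ * ‖f' s‖)
  have hvol : (volume : Measure (AddCircle (2 * Real.pi))).real univ = 2 * Real.pi := by
    simp [measureReal_def, Real.pi_pos.le]
  rw [integral_add (continuous_integrable (by fun_prop)) (integrable_const _), integral_const,
    integral_const, hvol, smul_eq_mul, smul_eq_mul] at h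
  rw [integral_add (continuous_integrable (by fun_prop)) (continuous_integrable (by fun_prop)),
    integral_const_mul, integral_const_mul]
  rw [← mul_le_mul_iff_right₀ hpi, mul_add, mul_inv_cancel_left₀ hpi.ne']
  exact h

/-- Ladyzhenskaya's argument: bound one factor ‖p‖² along the first variable and the other along the
second. Each bound depends only on the variable not integrated, so the integral of the product
factorizes. -/
theorem integral_norm_pow_four_le {p p₀ p₁ : AddCircle (2 * Real.pi) × AddCircle (2 * Real.pi) → E}
    (hp : Continuous p) (hp₀ : Continuous p₀) (hp₁ : Continuous p₁)
    (hd₀ : ∀ (s : ℝ) t, HasDerivAt (fun r : ℝ => p (r, t)) (p₀ (s, t)) s)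
    (hd₁ : ∀ s (t : ℝ), HasDerivAt (fun r : ℝ => p (s, r)) (p₁ (s, t)) t) :
    ∫ z, ‖p z‖ ^ 4 ≤ (∫ z, ((2 * Real.pi)⁻¹ * ‖p z‖ ^ 2 + 2 * (‖p z‖ * ‖p₀ z‖))) *
      ∫ z, ((2 * Real.pi)⁻¹ * ‖p z‖ ^ 2 + 2 * (‖p z‖ * ‖p₁ z‖)) := by
  have hpi := Real.two_pi_pos
  set G₀ := fun z => (2 * Real.pi)⁻¹ * ‖p z‖ ^ 2 + 2 * (‖p z‖ * ‖p₀ z‖) with hG₀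
  set G₁ := fun z => (2 * Real.pi)⁻¹ * ‖p z‖ ^ 2 + 2 * (‖p z‖ * ‖p₁ z‖) with hG₁
  have hc₀ : Continuous G₀ := by fun_prop
  have hc₁ : Continuous G₁ := by fun_prop
  have h₀ (z) : ‖p z‖ ^ 2 ≤ ∫ s, G₀ (s, z.2) :=
    norm_sq_le_integral (f := fun s => p (s, z.2)) (f' := fun s => p₀ (s, z.2)) (by fun_prop)
      (by fun_prop) (fun s => hd₀ s z.2) z.1
  have h₁ (z) : ‖p z‖ ^ 2 ≤ ∫ t, G₁ (z.1, t) :=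
    norm_sq_le_integral (f := fun t => p (z.1, t)) (f' := fun t => p₁ (z.1, t)) (by fun_prop)
      (by fun_prop) (fun t => hd₁ z.1 t) z.2
  have hi₀ : Integrable G₀ (volume.prod volume) := continuous_integrable hc₀
  have hi₁ : Integrable G₁ (volume.prod volume) := continuous_integrable hc₁
  calc ∫ z, ‖p z‖ ^ 4 ≤ ∫ z : AddCircle (2 * Real.pi) × AddCircle (2 * Real.pi),
        (∫ t, G₁ (z.1, t)) * ∫ s, G₀ (s, z.2) := by
        refine integral_mono (continuous_integrable (by fun_prop)) ?_ fun z => ?_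
        · exact Integrable.mul_prod hi₁.integral_prod_left hi₀.integral_prod_right
        · calc ‖p z‖ ^ 4 = ‖p z‖ ^ 2 * ‖p z‖ ^ 2 := by ring
            _ ≤ _ := mul_le_mul (h₁ z) (h₀ z) (by positivity) ((sq_nonneg _).trans (h₁ z))
    _ = (∫ s, ∫ t, G₁ (s, t)) * ∫ t, ∫ s, G₀ (s, t) :=
        integral_prod_mul (fun s => ∫ t, G₁ (s, t)) fun t => ∫ s, G₀ (s, t)
    _ = _ := by
        rw [mul_comm, ← integral_prod _ hi₁, ← integral_prod_symm _ hi₀]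
        rfl

end Circle

/-- The real trigonometric polynomial `Re ∑ c_k e^{i k·x}`. -/
def trigPoly (F : Finset (Fin 2 → ℤ)) (c : (Fin 2 → ℤ) → Fin 2 → ℂ) (x : Torus) :
    EuclideanSpace ℝ (Fin 2) :=
  WithLp.toLp 2 fun j => (∑ k ∈ F, c k j * character k x).re

theorem continuous_trigPoly (F : Finset (Fin 2 → ℤ)) (c : (Fin 2 → ℤ) → Fin 2 → ℂ) :
    Continuous (trigPoly F c) := by
  unfold trigPoly; fun_prop

theorem lowModes_ae_eq_trigPoly (N : ℝ) (u : VField) :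
    lowModes N u =ᵐ[volume] trigPoly (modes N) (coeff u) := by
  have h : ∀ᵐ x, ∀ j, ((lowModes N u x j : ℝ) : ℂ) = ∑ k ∈ modes N, coeff u k j * character k x :=
    ae_all_iff.2 fun j => lowModes_apply_ae N u j
  filter_upwards [h] with x hx
  ext j
  simp [trigPoly, ← hx]

theorem character_pair (k : Fin 2 → ℤ) (s t : AddCircle (2 * Real.pi)) :
    character k ![s, t] = fourier (k 0) s * fourier (k 1) t := by
  simp only [character_apply, Fin.prod_univ_two, Matrix.cons_val_zero, Matrix.cons_val_one]

theorem hasDerivAt_fourier_two_pi (n : ℤ) (s : ℝ) :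
    HasDerivAt (fun r : ℝ => fourier n (r : AddCircle (2 * Real.pi)))
      (Complex.I * n * fourier n (s : AddCircle (2 * Real.pi))) s := by
  convert hasDerivAt_fourier (2 * Real.pi) n s using 2
  have : (Real.pi : ℂ) ≠ 0 := by exact_mod_cast Real.pi_ne_zero
  push_cast
  field_simp

theorem hasDerivAt_trigPoly_aux (F : Finset (Fin 2 → ℤ)) (c d : (Fin 2 → ℤ) → Fin 2 → ℂ)
    (x : ℝ → Torus) (s : ℝ)
    (h : ∀ k j, HasDerivAt (fun r => c k j * character k (x r)) (d k j * character k (x s)) s) :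
    HasDerivAt (fun r => trigPoly F c (x r)) (trigPoly F d (x s)) s := by
  have h1 : HasDerivAt (fun r j => (∑ k ∈ F, c k j * character k (x r)).re)
      (fun j => (∑ k ∈ F, d k j * character k (x s)).re) s := hasDerivAt_pi.2 fun j =>
    Complex.reCLM.hasFDerivAt.comp_hasDerivAt s (HasDerivAt.fun_sum fun k _ => h k j)
  exact (PiLp.continuousLinearEquiv 2 ℝ fun _ : Fin 2 => ℝ).symm.hasFDerivAt.comp_hasDerivAt s h1

theorem hasDerivAt_trigPoly_fst (F : Finset (Fin 2 → ℤ)) (c : (Fin 2 → ℤ) → Fin 2 → ℂ) (s : ℝ)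
    (t : AddCircle (2 * Real.pi)) :
    HasDerivAt (fun r : ℝ => trigPoly F c ![(r : AddCircle (2 * Real.pi)), t])
      (trigPoly F (fun k j => derivSymbol 0 k * c k j) ![(s : AddCircle (2 * Real.pi)), t]) s := by
  refine hasDerivAt_trigPoly_aux F c _ (fun r => ![(r : AddCircle (2 * Real.pi)), t]) s fun k j => ?_
  simp only [character_pair, derivSymbol]
  exact (((hasDerivAt_fourier_two_pi (k 0) s).mul_const (fourier (k 1) t)).const_mul
    (c k j)).congr_deriv (by ring)

theorem hasDerivAt_trigPoly_snd (F : Finset (Fin 2 → ℤ)) (c : (Fin 2 → ℤ) → Fin 2 → ℂ)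
    (s : AddCircle (2 * Real.pi)) (t : ℝ) :
    HasDerivAt (fun r : ℝ => trigPoly F c ![s, (r : AddCircle (2 * Real.pi))])
      (trigPoly F (fun k j => derivSymbol 1 k * c k j) ![s, (t : AddCircle (2 * Real.pi))]) t := by
  refine hasDerivAt_trigPoly_aux F c _ (fun r => ![s, (r : AddCircle (2 * Real.pi))]) t fun k j => ?_
  simp only [character_pair, derivSymbol]
  exact (((hasDerivAt_fourier_two_pi (k 1) t).const_mul (fourier (k 0) s)).const_mul
    (c k j)).congr_deriv (by ring)

theorem integral_torus_eq_prod (f : Torus → ℝ) :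
    ∫ x, f x = ∫ z : AddCircle (2 * Real.pi) × AddCircle (2 * Real.pi), f ![z.1, z.2] := by
  have h := volume_preserving_finTwoArrow (AddCircle (2 * Real.pi))
  rw [← h.symm.integral_comp']
  rfl

theorem integral_trigPoly_pow_four_le (F : Finset (Fin 2 → ℤ)) (c : (Fin 2 → ℤ) → Fin 2 → ℂ) :
    ∫ x, ‖trigPoly F c x‖ ^ 4 ≤ ∏ i, ∫ x, ((2 * Real.pi)⁻¹ * ‖trigPoly F c x‖ ^ 2 +
      2 * (‖trigPoly F c x‖ * ‖trigPoly F (fun k j => derivSymbol i k * c k j) x‖)) := by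
  have hc (d) : Continuous fun z : AddCircle (2 * Real.pi) × AddCircle (2 * Real.pi) =>
      trigPoly F d ![z.1, z.2] := (continuous_trigPoly F d).comp (by fun_prop)
  rw [Fin.prod_univ_two]
  simp only [integral_torus_eq_prod]
  exact integral_norm_pow_four_le (hc c) (hc _) (hc _) (hasDerivAt_trigPoly_fst F c)
    (hasDerivAt_trigPoly_snd F c)

theorem integral_mul_le_sqrt {f g : Torus → ℝ} (hf : MemLp f 2 volume) (hg : MemLp g 2 volume) :
    ∫ x, f x * g x ≤ √(∫ x, f x ^ 2) * √(∫ x, g x ^ 2) := by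
  have key {f g : Torus → ℝ} (hf : MemLp f 2 volume) (hg : MemLp g 2 volume) :
      inner ℝ (hf.toLp f) (hg.toLp g) = ∫ x, f x * g x := by
    rw [L2.inner_def]
    refine integral_congr_ae ?_
    filter_upwards [hf.coeFn_toLp, hg.coeFn_toLp] with x h1 h2
    simp [h1, h2, mul_comm]
  have h := real_inner_le_norm (hf.toLp f) (hg.toLp g)
  rw [norm_eq_sqrt_real_inner, norm_eq_sqrt_real_inner (hg.toLp g), key, key, key] at h
  simpa only [sq] using h

/-! ### From trigonometric polynomials to Ladyzhenskaya's inequality on V -/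

theorem norm_sq_eq_integral (u : VField) : ‖u‖ ^ 2 = ∫ x, ‖u x‖ ^ 2 := by
  rw [← real_inner_self_eq_norm_sq, L2.inner_def]
  simp only [real_inner_self_eq_norm_sq]

theorem integral_norm_mul_norm_le (u v : VField) : ∫ x, ‖u x‖ * ‖v x‖ ≤ ‖u‖ * ‖v‖ := by
  have h := integral_mul_le_sqrt (Lp.memLp u).norm (Lp.memLp v).norm
  rwa [← norm_sq_eq_integral, ← norm_sq_eq_integral, Real.sqrt_sq (norm_nonneg _),
    Real.sqrt_sq (norm_nonneg _)] at h

theorem eLpNorm_four_pow {f : Torus → EuclideanSpace ℝ (Fin 2)}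
    (hf : Integrable (fun x => ‖f x‖ ^ 4) volume) :
    eLpNorm f 4 volume ^ 4 = ENNReal.ofReal (∫ x, ‖f x‖ ^ 4) := by
  rw [eLpNorm_eq_lintegral_rpow_enorm_toReal (by norm_num) (by norm_num),
    ofReal_integral_eq_lintegral_ofReal hf (.of_forall fun x => by positivity)]
  simp only [ENNReal.toReal_ofNat, ENNReal.rpow_ofNat, one_div]
  rw [← ENNReal.rpow_natCast, ← ENNReal.rpow_mul]
  norm_num

theorem norm_pderiv_le_normV (u : VField) (j : Fin 2) : ‖pderiv j u‖ ≤ normV u := by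
  refine (pow_le_pow_iff_left₀ (norm_nonneg _) (normV_nonneg u) two_ne_zero).1 ?_
  rw [normV_sq]
  exact Finset.single_le_sum (f := fun i => ‖pderiv i u‖ ^ 2) (fun i _ => by positivity)
    (Finset.mem_univ j)

/-- The constant is 11/5 = 1/5 + 2: the mean-value term has factor 1/(2π) ≤ 1/5 and Poincaré turns
|u|² into ‖u‖ |u|, while the derivative term has factor 2. The right side uses u itself, so it is
uniform in N. -/
theorem MemV.ladyzhenskaya_lowModes {u : VField} (h : MemV u) (N : ℝ) :
    eLpNorm (NSE.lowModes N u) 4 volume ^ 2 ≤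
      ENNReal.ofReal (11 / 5 * (normV u * ‖u‖)) := by
  have hu := lowModes_ae_eq_trigPoly N u
  set p := trigPoly (modes N) (coeff u) with hp
  have hX : 0 ≤ 11 / 5 * (normV u * ‖u‖) :=
    mul_nonneg (by norm_num) (mul_nonneg (normV_nonneg u) (norm_nonneg u))
  have hpc : Continuous p := continuous_trigPoly _ _
  have hfac (i : Fin 2) : ∫ x, ((2 * Real.pi)⁻¹ * ‖p x‖ ^ 2 + 2 * (‖p x‖ *
      ‖trigPoly (modes N) (fun k j => derivSymbol i k * coeff u k j) x‖)) ≤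
      11 / 5 * (normV u * ‖u‖) := by
    have hd := lowModes_ae_eq_trigPoly N (pderiv i u)
    have he : coeff (pderiv i u) = fun k j => derivSymbol i k * coeff u k j :=
      funext₂ (h.isMultiplier_pderiv i)
    rw [he] at hd
    set q := trigPoly (modes N) (fun k j => derivSymbol i k * coeff u k j)
    have hqc : Continuous q := continuous_trigPoly _ _
    rw [integral_add (continuous_integrable (by fun_prop)) (continuous_integrable (by fun_prop)),
      integral_const_mul, integral_const_mul]
    have h1 : ∫ x, ‖p x‖ ^ 2 = ‖NSE.lowModes N u‖ ^ 2 := by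
      rw [norm_sq_eq_integral]
      exact integral_congr_ae (hu.mono fun x hx => by simp only [hx])
    have h2 : ∫ x, ‖p x‖ * ‖q x‖ = ∫ x, ‖NSE.lowModes N u x‖ * ‖NSE.lowModes N (pderiv i u) x‖ :=
      integral_congr_ae (by filter_upwards [hu, hd] with x hx hx'; simp only [hx, hx'])
    have h3 := integral_norm_mul_norm_le (NSE.lowModes N u) (NSE.lowModes N (pderiv i u))
    rw [h1, h2]
    have h4 := norm_lowModes_le N u
    have h5 := (norm_lowModes_le N (pderiv i u)).trans (norm_pderiv_le_normV u i)
    have h6 := h.norm_le_normV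
    have h7 : (2 * Real.pi)⁻¹ ≤ 1 / 5 := by
      rw [inv_le_comm₀ Real.two_pi_pos (by norm_num)]; linarith [Real.pi_gt_three]
    have h8 : ‖NSE.lowModes N u‖ ^ 2 ≤ normV u * ‖u‖ := by
      rw [sq]; gcongr; exacts [normV_nonneg u, h4.trans h6]
    have h9 : ‖NSE.lowModes N u‖ * ‖NSE.lowModes N (pderiv i u)‖ ≤ normV u * ‖u‖ := by
      rw [mul_comm]; gcongr; exact normV_nonneg u
    have h10 : (2 * Real.pi)⁻¹ * ‖NSE.lowModes N u‖ ^ 2 ≤ 1 / 5 * (normV u * ‖u‖) := by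
      gcongr
    linarith
  have h4 : ∫ x, ‖p x‖ ^ 4 ≤ (11 / 5 * (normV u * ‖u‖)) ^ 2 := by
    refine (integral_trigPoly_pow_four_le (modes N) (coeff u)).trans ?_
    refine (Finset.prod_le_prod (fun i _ => integral_nonneg fun x => ?_) fun i _ => hfac i).trans ?_
    · positivity
    · simp
  have h5 := eLpNorm_four_pow (f := p) (continuous_integrable (by fun_prop))
  rw [eLpNorm_congr_ae hu]
  refine (ENNReal.pow_le_pow_left_iff two_ne_zero).1 ?_
  rw [← pow_mul, h5, ← ENNReal.ofReal_pow hX]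
  exact ENNReal.ofReal_le_ofReal h4

/-- The truncations converge to u in L², hence almost everywhere along a subsequence; Fatou's lemma
carries their uniform L⁴ bound to u. -/
theorem isLadyzhenskayaConst : IsLadyzhenskayaConst (11 / 5) := by
  refine ⟨by norm_num, fun u hu => ?_⟩
  have h1 : TendstoInMeasure volume (fun n : ℕ => (lowModes n u : Torus → _)) atTop u :=
    tendstoInMeasure_of_tendsto_Lp (tendsto_lowModes u)
  obtain ⟨ns, -, hns⟩ := h1.exists_seq_tendsto_ae
  have h2 := Lp.eLpNorm_lim_le_liminf_eLpNorm (p := 4)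
    (fun n => Lp.aestronglyMeasurable (lowModes (ns n) u)) u hns
  set X := ENNReal.ofReal (11 / 5 * (normV u * ‖u‖)) with hX
  have h3 (N : ℝ) : eLpNorm (lowModes N u) 4 volume ≤ X ^ (2⁻¹ : ℝ) := by
    have := hu.ladyzhenskaya_lowModes N
    rw [ENNReal.le_rpow_inv_iff (by norm_num)]
    simpa using this
  have h4 : eLpNorm u 4 volume ≤ X ^ (2⁻¹ : ℝ) := by
    refine h2.trans ((liminf_le_liminf (.of_forall fun n => h3 (ns n))).trans ?_)
    simp
  rw [ENNReal.le_rpow_inv_iff (by norm_num)] at h4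
  simpa using h4

/-! ## The trilinear form -/

/-- `b(u, v, w) = ∫ ((u · ∇) v) · w`. -/
def trilinear (u v w : VField) : ℝ := ∫ x, inner ℝ (advection u v x) (w x)

/-- `|∇v|`, pointwise. -/
def gradNorm (v : VField) (x : Torus) : ℝ := √(∑ j, ‖pderiv j v x‖ ^ 2)

theorem MemV.eLpNorm_four_lt_top {u : VField} (h : MemV u) : eLpNorm u 4 volume < ⊤ := by
  have h1 := isLadyzhenskayaConst.2 u h
  by_contra! h2
  rw [top_le_iff.1 h2] at h1
  simp at h1

theorem MemV.memLp_four {u : VField} (h : MemV u) : MemLp u 4 volume :=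
  ⟨Lp.aestronglyMeasurable u, h.eLpNorm_four_lt_top⟩

theorem MemV.integrable_norm_pow_four {u : VField} (h : MemV u) :
    Integrable (fun x => ‖u x‖ ^ 4) volume := by
  simpa using h.memLp_four.integrable_norm_pow (by norm_num)

theorem IsLadyzhenskayaConst.sqrt_integral_le {C : ℝ} (hC : IsLadyzhenskayaConst C) {u : VField}
    (h : MemV u) : √(∫ x, ‖u x‖ ^ 4) ≤ C * (normV u * ‖u‖) := by
  have hX : 0 ≤ C * (normV u * ‖u‖) :=
    mul_nonneg hC.1.le (mul_nonneg (normV_nonneg u) (norm_nonneg u))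
  rw [Real.sqrt_le_left hX, ← ENNReal.ofReal_le_ofReal_iff (by positivity),
    ← eLpNorm_four_pow h.integrable_norm_pow_four, ENNReal.ofReal_pow hX,
    show (4 : ℕ) = 2 * 2 from rfl, pow_mul]
  exact pow_le_pow_left' (hC.2 u h) 2

theorem memLp_norm_sq {u : VField} (h : MemV u) : MemLp (fun x => ‖u x‖ ^ 2) 2 volume := by
  have := h.memLp_four.norm.mul (p := 4) (r := 2) h.memLp_four.norm
    (hpqr := ⟨by rw [← two_mul]; rw [← ENNReal.toReal_eq_toReal_iff' (by finiteness) (by finiteness)]; norm_num⟩)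
  simpa [sq, Pi.mul_def] using this

theorem memLp_norm_mul_norm {u w : VField} (hu : MemV u) (hw : MemV w) :
    MemLp (fun x => ‖u x‖ * ‖w x‖) 2 volume := by
  refine ((memLp_norm_sq hu).add (memLp_norm_sq hw)).mono
    ((Lp.aestronglyMeasurable u).norm.mul (Lp.aestronglyMeasurable w).norm) (.of_forall fun x => ?_)
  simp only [Pi.add_apply]
  rw [Real.norm_of_nonneg (by positivity), Real.norm_of_nonneg (by positivity)]
  nlinarith [sq_nonneg (‖u x‖ - ‖w x‖), sq_nonneg (‖u x‖), sq_nonneg (‖w x‖)]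

theorem gradNorm_sq (v : VField) (x : Torus) : gradNorm v x ^ 2 = ∑ j, ‖pderiv j v x‖ ^ 2 :=
  Real.sq_sqrt (by positivity)

theorem aestronglyMeasurable_gradNorm (v : VField) : AEStronglyMeasurable (gradNorm v) volume :=
  Real.continuous_sqrt.comp_aestronglyMeasurable
    (Finset.aestronglyMeasurable_fun_sum _ fun j _ => (Lp.aestronglyMeasurable (pderiv j v)).norm.pow 2)

theorem integrable_norm_sq (u : VField) : Integrable (fun x => ‖u x‖ ^ 2) volume :=
  (Lp.memLp u).integrable_norm_pow (by norm_num)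

theorem memLp_gradNorm (v : VField) : MemLp (gradNorm v) 2 volume := by
  rw [memLp_two_iff_integrable_sq (aestronglyMeasurable_gradNorm v)]
  simp only [gradNorm_sq]
  exact integrable_finsetSum _ fun j _ => integrable_norm_sq _

theorem sqrt_integral_gradNorm_sq (v : VField) : √(∫ x, gradNorm v x ^ 2) = normV v := by
  simp only [gradNorm_sq]
  rw [integral_finsetSum _ fun j _ => integrable_norm_sq _, normV]
  simp only [norm_sq_eq_integral]

theorem norm_advection_le (u v : VField) (x : Torus) :
    ‖advection u v x‖ ≤ ‖u x‖ * gradNorm v x := by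
  refine (norm_sum_le _ _).trans ?_
  simp only [norm_smul, gradNorm]
  rw [EuclideanSpace.norm_eq, ← Real.sqrt_mul (by positivity)]
  exact Real.le_sqrt_of_sq_le (Finset.sum_mul_sq_le_sq_mul_sq _ _ _)

theorem aestronglyMeasurable_apply (u : VField) (j : Fin 2) :
    AEStronglyMeasurable (fun x => u x j) volume := (memLp_apply u j).aestronglyMeasurable

theorem aestronglyMeasurable_advection (u v : VField) :
    AEStronglyMeasurable (advection u v) volume :=
  Finset.aestronglyMeasurable_fun_sum _ fun j _ =>
    (aestronglyMeasurable_apply u j).smul (Lp.aestronglyMeasurable (pderiv j v))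

theorem norm_inner_advection_le (u v w : VField) (x : Torus) :
    ‖(inner ℝ (advection u v x) (w x) : ℝ)‖ ≤ ‖u x‖ * ‖w x‖ * gradNorm v x := by
  refine (norm_inner_le_norm _ _).trans ?_
  calc ‖advection u v x‖ * ‖w x‖ ≤ ‖u x‖ * gradNorm v x * ‖w x‖ := by
        gcongr; exact norm_advection_le u v x
    _ = _ := by ring

theorem integrable_inner_advection {u w : VField} (hu : MemV u) (v : VField) (hw : MemV w) :
    Integrable (fun x => (inner ℝ (advection u v x) (w x) : ℝ)) volume :=
  ((memLp_norm_mul_norm hu hw).integrable_mul (memLp_gradNorm v)).mono'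
    ((aestronglyMeasurable_advection u v).inner (Lp.aestronglyMeasurable w))
    (.of_forall fun x => norm_inner_advection_le u v w x)

/-- Cauchy–Schwarz twice, first separating |∇v| from |u||w|, then |u|² from |w|², followed by
Ladyzhenskaya for u and w. -/
theorem abs_trilinear_le {C : ℝ} (hC : IsLadyzhenskayaConst C) {u w : VField} (hu : MemV u)
    (v : VField) (hw : MemV w) :
    |trilinear u v w| ≤ C * √((normV u * ‖u‖) * (normV w * ‖w‖)) * normV v := by
  have hu0 : 0 ≤ normV u * ‖u‖ := mul_nonneg (normV_nonneg u) (norm_nonneg u)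
  have hw0 : 0 ≤ normV w * ‖w‖ := mul_nonneg (normV_nonneg w) (norm_nonneg w)
  have h1 : |trilinear u v w| ≤ ∫ x, ‖u x‖ * ‖w x‖ * gradNorm v x :=
    norm_integral_le_of_norm_le
      ((memLp_norm_mul_norm hu hw).integrable_mul (memLp_gradNorm v))
      (.of_forall fun x => norm_inner_advection_le u v w x)
  have h2 := integral_mul_le_sqrt (memLp_norm_mul_norm hu hw) (memLp_gradNorm v)
  rw [sqrt_integral_gradNorm_sq] at h2
  refine h1.trans (h2.trans ?_)
  gcongr
  · exact normV_nonneg v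
  have h3 := integral_mul_le_sqrt (memLp_norm_sq hu) (memLp_norm_sq hw)
  simp only [← pow_mul, ← mul_pow] at h3
  have h4 : (∫ x, (‖u x‖ * ‖w x‖) ^ 2) ≤ C * (normV u * ‖u‖) * (C * (normV w * ‖w‖)) :=
    h3.trans (mul_le_mul (hC.sqrt_integral_le hu) (hC.sqrt_integral_le hw) (Real.sqrt_nonneg _)
      (mul_nonneg hC.1.le hu0))
  calc √(∫ x, (‖u x‖ * ‖w x‖) ^ 2) ≤ √(C ^ 2 * ((normV u * ‖u‖) * (normV w * ‖w‖))) :=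
        Real.sqrt_le_sqrt (h4.trans_eq (by ring))
    _ = _ := by rw [Real.sqrt_mul (sq_nonneg C), Real.sqrt_sq hC.1.le]

theorem abs_trilinear_self_le {C : ℝ} (hC : IsLadyzhenskayaConst C) {u : VField} (hu : MemV u)
    (v : VField) : |trilinear u v u| ≤ C * (normV u * ‖u‖) * normV v := by
  have h := abs_trilinear_le hC hu v hu
  rwa [Real.sqrt_mul_self (mul_nonneg (normV_nonneg u) (norm_nonneg u))] at h

theorem trilinear_sub_left {u u' w : VField} (hu : MemV u) (hu' : MemV u') (v : VField)
    (hw : MemV w) : trilinear (u - u') v w = trilinear u v w - trilinear u' v w := by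
  rw [trilinear, trilinear, trilinear, ← integral_sub (integrable_inner_advection hu v hw)
    (integrable_inner_advection hu' v hw)]
  refine integral_congr_ae ?_
  filter_upwards [Lp.coeFn_sub u u'] with x hx
  simp only [advection, hx, Pi.sub_apply, PiLp.sub_apply, sub_smul, Finset.sum_sub_distrib,
    inner_sub_left]

theorem trilinear_sub_middle {u v v' w : VField} (hu : MemV u) (hv : MemV v) (hv' : MemV v')
    (hw : MemV w) : trilinear u (v - v') w = trilinear u v w - trilinear u v' w := by
  rw [trilinear, trilinear, trilinear, ← integral_sub (integrable_inner_advection hu v hw)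
    (integrable_inner_advection hu v' hw)]
  have h : ∀ᵐ x, ∀ j, pderiv j (v - v') x = pderiv j v x - pderiv j v' x := by
    rw [ae_all_iff]
    intro j
    rw [hv.pderiv_sub hv']
    exact Lp.coeFn_sub _ _
  refine integral_congr_ae ?_
  filter_upwards [h] with x hx
  simp only [advection, hx, smul_sub, Finset.sum_sub_distrib, inner_sub_left]

theorem trilinear_sub_right {u w w' : VField} (hu : MemV u) (v : VField)
    (hw : MemV w) (hw' : MemV w') :
    trilinear u v (w - w') = trilinear u v w - trilinear u v w' := by
  rw [trilinear, trilinear, trilinear, ← integral_sub (integrable_inner_advection hu v hw)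
    (integrable_inner_advection hu v hw')]
  refine integral_congr_ae ?_
  filter_upwards [Lp.coeFn_sub w w'] with x hx
  simp only [hx, Pi.sub_apply, inner_sub_right]

/-! ### Antisymmetry -/

theorem integral_character_mul_apply (u : VField) (k : Fin 2 → ℤ) (j : Fin 2) :
    ∫ x, character k x * ((u x j : ℝ) : ℂ) = (((2 * Real.pi) ^ 2 : ℝ) : ℂ) * coeff u (-k) j := by
  have h : (((2 * Real.pi) ^ 2 : ℝ) : ℂ) ≠ 0 := by
    exact_mod_cast (pow_pos Real.two_pi_pos 2).ne'
  rw [coeff, mul_inv_cancel_left₀ h]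
  simp only [character_neg, Complex.conj_conj]

theorem sum_wave_mul_integral {u : VField} (hu : u ∈ H) (k : Fin 2 → ℤ) :
    ∑ j, (k j : ℂ) * ∫ x, character k x * ((u x j : ℝ) : ℂ) = 0 := by
  have h := hu.2 (-k)
  simp only [Fin.sum_univ_two, Pi.neg_apply, Int.cast_neg, integral_character_mul_apply] at h ⊢
  linear_combination (-(((2 * Real.pi) ^ 2 : ℝ) : ℂ)) * h

/-- Expanding in exponentials gives a double sum over k, l in which u enters through k · û_{-(k+l)}.
Symmetrizing in k and l replaces k by k + l, and the factor then vanishes since u is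
divergence-free. -/
theorem trilinear_lowModes_self {u w : VField} (hu : u ∈ H) (hw : MemV w) (N : ℝ) :
    trilinear u (lowModes N w) (lowModes N w) = 0 := by
  set c := coeff w with hc
  have ha : ∀ᵐ x, ∀ i, ((lowModes N w x i : ℝ) : ℂ) = ∑ k ∈ modes N, c k i * character k x :=
    ae_all_iff.2 fun i => lowModes_apply_ae N w i
  have hd : ∀ᵐ x, ∀ j i, ((pderiv j (lowModes N w) x i : ℝ) : ℂ) =
      ∑ k ∈ modes N, Complex.I * (k j : ℂ) * c k i * character k x := by
    refine ae_all_iff.2 fun j => ae_all_iff.2 fun i => ?_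
    rw [hw.pderiv_lowModes]
    filter_upwards [lowModes_apply_ae N (pderiv j w) i] with x hx
    simpa only [hw.isMultiplier_pderiv j _ i, derivSymbol] using hx
  let D (m : Fin 2 → ℤ) (j : Fin 2) : ℂ := ∫ x, character m x * ((u x j : ℝ) : ℂ)
  have hint (m : Fin 2 → ℤ) (j : Fin 2) :
      Integrable (fun x => character m x * ((u x j : ℝ) : ℂ)) volume := by
    have h1 : Integrable (fun x => ((u x j : ℝ) : ℂ)) volume :=
      ((memLp_apply u j).integrable (by norm_num)).ofReal
    exact h1.bdd_mul (c := 1) (by fun_prop) (.of_forall fun x => (norm_character_apply m x).le)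
  have hS : ((trilinear u (lowModes N w) (lowModes N w) : ℝ) : ℂ) =
      ∑ k ∈ modes N, ∑ l ∈ modes N, ∑ i, Complex.I * c k i * c l i *
        ∑ j, (k j : ℂ) * D (k + l) j := by
    have h1 : ((trilinear u (lowModes N w) (lowModes N w) : ℝ) : ℂ) =
        ∫ x, ∑ k ∈ modes N, ∑ l ∈ modes N, ∑ i, ∑ j, Complex.I * c k i * c l i * (k j : ℂ) *
          (character (k + l) x * ((u x j : ℝ) : ℂ)) := by
      rw [trilinear, ← integral_complex_ofReal]
      refine integral_congr_ae ?_
      filter_upwards [ha, hd] with x ha hd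
      have h2 : ((inner ℝ (advection u (lowModes N w) x) (lowModes N w x) : ℝ) : ℂ) =
          ∑ i, ∑ j, ((u x j : ℝ) : ℂ) * ((pderiv j (lowModes N w) x i : ℝ) : ℂ) *
            ((lowModes N w x i : ℝ) : ℂ) := by
        simp [advection, PiLp.inner_apply, Fin.sum_univ_two]
        ring
      simp only [h2, ha, hd, Finset.mul_sum, Finset.sum_mul]
      simp only [Fin.sum_univ_two, ← Finset.sum_add_distrib, character_add]
      rw [Finset.sum_comm]
      refine Finset.sum_congr rfl fun k _ => Finset.sum_congr rfl fun l _ => ?_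
      ring
    rw [h1]
    rw [integral_finsetSum _ fun k _ => integrable_finsetSum _ fun l _ =>
      integrable_finsetSum _ fun i _ => integrable_finsetSum _ fun j _ => (hint _ j).const_mul _]
    refine Finset.sum_congr rfl fun k _ => ?_
    rw [integral_finsetSum _ fun l _ =>
      integrable_finsetSum _ fun i _ => integrable_finsetSum _ fun j _ => (hint _ j).const_mul _]
    refine Finset.sum_congr rfl fun l _ => ?_
    rw [integral_finsetSum _ fun i _ => integrable_finsetSum _ fun j _ => (hint _ j).const_mul _]
    refine Finset.sum_congr rfl fun i _ => ?_
    rw [integral_finsetSum _ fun j _ => (hint _ j).const_mul _, Finset.mul_sum]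
    refine Finset.sum_congr rfl fun j _ => ?_
    rw [integral_const_mul, mul_assoc _ (k j : ℂ)]
  -- The same sum with the roles of k and l exchanged; adding the two copies symmetrizes.
  have hS' := hS
  rw [Finset.sum_comm] at hS'
  have h0 : ((trilinear u (lowModes N w) (lowModes N w) : ℝ) : ℂ) +
      ((trilinear u (lowModes N w) (lowModes N w) : ℝ) : ℂ) = 0 := by
    nth_rewrite 1 [hS]
    rw [hS']
    simp only [← Finset.sum_add_distrib]
    refine Finset.sum_eq_zero fun k _ => Finset.sum_eq_zero fun l _ => Finset.sum_eq_zero fun i _ => ?_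
    have h1 := sum_wave_mul_integral hu (k + l)
    simp only [Fin.sum_univ_two, Pi.add_apply, Int.cast_add] at h1
    simp only [Fin.sum_univ_two, add_comm l k]
    linear_combination (Complex.I * c k i * c l i) * h1
  have h2 : trilinear u (lowModes N w) (lowModes N w) +
      trilinear u (lowModes N w) (lowModes N w) = 0 := by exact_mod_cast h0
  linarith

/-- Density: with a = P_n w, b(u, a, a) = 0 gives b(u, w, w) = -b(u, a - w, a) - b(u, w, a - w), and
both terms tend to 0 because a → w in V. -/
theorem trilinear_self {u w : VField} (hu : MemV u) (hw : MemV w) : trilinear u w w = 0 := by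
  set a : ℕ → VField := fun n => lowModes n w with ha
  have hav (n : ℕ) : MemV (a n) := hw.lowModes n
  have hd (n : ℕ) : MemV (a n - w) := (hav n).sub hw
  have h1 : Tendsto (fun n => normV (a n - w)) atTop (𝓝 0) := hw.tendsto_normV_lowModes_sub
  have h2 : Tendsto (fun n => ‖a n - w‖) atTop (𝓝 0) :=
    tendsto_iff_norm_sub_tendsto_zero.1 (tendsto_lowModes w)
  have key (n : ℕ) : |trilinear u w w| ≤
      11 / 5 * √((normV u * ‖u‖) * (normV w * ‖w‖)) * normV (a n - w) +
      11 / 5 * √((normV u * ‖u‖) * (normV (a n - w) * ‖a n - w‖)) * normV w := by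
    have h3 := abs_trilinear_le isLadyzhenskayaConst hu (a n - w) (hav n)
    have h4 := abs_trilinear_le isLadyzhenskayaConst hu w (hd n)
    rw [trilinear_sub_middle hu (hav n) hw (hav n), trilinear_lowModes_self hu.1 hw] at h3
    rw [trilinear_sub_right hu w (hav n) hw] at h4
    have h5 : √((normV u * ‖u‖) * (normV (a n) * ‖a n‖)) ≤
        √((normV u * ‖u‖) * (normV w * ‖w‖)) := by
      have := normV_nonneg u
      have := normV_nonneg w
      gcongr
      · exact hw.normV_lowModes_le n
      · exact norm_lowModes_le n w
    have h6 : 11 / 5 * √((normV u * ‖u‖) * (normV (a n) * ‖a n‖)) * normV (a n - w) ≤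
        11 / 5 * √((normV u * ‖u‖) * (normV w * ‖w‖)) * normV (a n - w) := by
      have := normV_nonneg (a n - w)
      gcongr
    rw [abs_le] at h3 h4 ⊢
    constructor <;> linarith [h3.1, h3.2, h4.1, h4.2]
  have hlim : Tendsto (fun n =>
      11 / 5 * √((normV u * ‖u‖) * (normV w * ‖w‖)) * normV (a n - w) +
      11 / 5 * √((normV u * ‖u‖) * (normV (a n - w) * ‖a n - w‖)) * normV w) atTop (𝓝 0) := by
    have h7 := (h1.mul h2).const_mul (normV u * ‖u‖)
    have h8 := (((Real.continuous_sqrt.tendsto _).comp h7).const_mul (11 / 5)).mul_const (normV w)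
    have h9 := (h1.const_mul (11 / 5 * √((normV u * ‖u‖) * (normV w * ‖w‖)))).add h8
    simpa [Function.comp_def] using h9
  exact abs_nonpos_iff.1 (ge_of_tendsto' hlim key)

/-! ### The nonlinear term -/

theorem memLp_advection {u v : VField} (hu : MemV u) (hv : MemDA v) :
    MemLp (advection u v) 2 volume := by
  refine memLp_finsetSum _ fun j _ => ?_
  refine (memLp_norm_mul_norm hu (hv.memV_pderiv j)).mono
    ((aestronglyMeasurable_apply u j).smul (Lp.aestronglyMeasurable (pderiv j v)))
    (.of_forall fun x => ?_)
  rw [norm_smul, norm_mul, norm_norm, norm_norm]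
  gcongr
  exact PiLp.norm_apply_le (u x) j

theorem inner_B {u v w : VField} (hu : MemV u) (hv : MemDA v) (hw : w ∈ H) :
    inner ℝ (B u v) w = trilinear u v w := by
  have h := memLp_advection hu hv
  rw [B, dif_pos h, inner_leray hw, L2.inner_def, trilinear]
  refine integral_congr_ae ?_
  filter_upwards [h.coeFn_toLp] with x hx
  rw [hx]

theorem inner_B_self {v : VField} (hv : MemDA v) : inner ℝ (B v v) v = 0 := by
  rw [inner_B hv.memV hv hv.1, trilinear_self hv.memV hv.memV]

/-- With w = v₁ - v₂ the difference is B(v₁, w) + B(w, v₂), and the first term is orthogonal to w.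
-/
theorem inner_B_sub_B {v₁ v₂ : VField} (h₁ : MemDA v₁) (h₂ : MemDA v₂) :
    inner ℝ (B v₁ v₁ - B v₂ v₂) (v₁ - v₂) = trilinear (v₁ - v₂) v₂ (v₁ - v₂) := by
  have hw := h₁.memV.sub h₂.memV
  rw [inner_sub_left, inner_B h₁.memV h₁ hw.1, inner_B h₂.memV h₂ hw.1,
    trilinear_sub_left h₁.memV h₂.memV v₂ hw]
  have h := trilinear_self h₁.memV hw
  rw [trilinear_sub_middle h₁.memV h₁.memV h₂.memV hw] at h
  linarith

/-! ## Energy identity and Grönwall's inequality -/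

section Time

variable {E : Type*} [NormedAddCommGroup E] [InnerProductSpace ℝ E] [CompleteSpace E]

/-- Domination of increments transfers absolute continuity. -/
theorem AbsolutelyContinuousOnInterval.of_dist_le {φ R : ℝ → ℝ} {a b M : ℝ}
    (hR : AbsolutelyContinuousOnInterval R a b)
    (h : ∀ x ∈ uIcc a b, ∀ y ∈ uIcc a b, dist (φ x) (φ y) ≤ M * dist (R x) (R y)) :
    AbsolutelyContinuousOnInterval φ a b := by
  unfold AbsolutelyContinuousOnInterval at hR ⊢
  refine squeeze_zero' (.of_forall fun _ => Finset.sum_nonneg fun _ _ => dist_nonneg) ?_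
    (by simpa using hR.const_mul M)
  rw [eventually_inf_principal]
  filter_upwards with p hp
  rw [Finset.mul_sum]
  refine Finset.sum_le_sum fun i hi => ?_
  have := hp.1 i hi
  exact h _ this.1 _ this.2

/-- The chain rule for |W|² when W is only a primitive of an integrable function. Both |W|² and the
integral of 2(W, h) are absolutely continuous with the same derivative almost everywhere, so they
differ by a constant. -/
theorem norm_sq_primitive_sub {h : ℝ → E} {a b : ℝ} (hh : IntervalIntegrable h volume a b) (c : E) :
    IntervalIntegrable (fun x => 2 * inner ℝ (c + ∫ t in a..x, h t) (h x)) volume a b ∧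
    ‖c + ∫ t in a..b, h t‖ ^ 2 - ‖c‖ ^ 2 =
      ∫ x in a..b, 2 * inner ℝ (c + ∫ t in a..x, h t) (h x) := by
  set W : ℝ → E := fun x => c + ∫ t in a..x, h t with hW
  have hWc : ContinuousOn W (uIcc a b) :=
    continuousOn_const.add (intervalIntegral.continuousOn_primitive_interval' hh left_mem_uIcc)
  obtain ⟨M, hM⟩ := isCompact_uIcc.exists_bound_of_continuousOn hWc
  have hM0 : 0 ≤ M := (norm_nonneg _).trans (hM a left_mem_uIcc)
  have hi : IntervalIntegrable (fun x => 2 * inner ℝ (W x) (h x)) volume a b := by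
    refine IntervalIntegrable.const_mul ?_ 2
    have hm : AEStronglyMeasurable W (volume.restrict (uIoc a b)) :=
      (hWc.aestronglyMeasurable measurableSet_uIcc).mono_measure
        (Measure.restrict_mono uIoc_subset_uIcc le_rfl)
    refine (hh.norm.const_mul M).mono_fun' (hm.inner hh.aestronglyMeasurable_restrict_uIoc) ?_
    rw [EventuallyLE, ae_restrict_iff' measurableSet_uIoc]
    refine .of_forall fun x hx => (norm_inner_le_norm _ _).trans ?_
    exact mul_le_mul_of_nonneg_right (hM x (uIoc_subset_uIcc hx)) (norm_nonneg _)
  refine ⟨hi, ?_⟩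
  have hsub {x y : ℝ} (hx : x ∈ uIcc a b) (hy : y ∈ uIcc a b) : IntervalIntegrable h volume x y :=
    hh.mono_set (uIcc_subset_uIcc hx hy)
  have hR := hh.norm.absolutelyContinuousOnInterval_intervalIntegral (c := a) left_mem_uIcc
  have hφ : AbsolutelyContinuousOnInterval (fun x => ‖W x‖ ^ 2) a b := by
    refine AbsolutelyContinuousOnInterval.of_dist_le (M := 2 * M) hR fun x hx y hy => ?_
    have h1 : W x - W y = ∫ t in y..x, h t := by
      simp only [hW, add_sub_add_left_eq_sub]
      exact intervalIntegral.integral_interval_sub_left (hsub left_mem_uIcc hx)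
        (hsub left_mem_uIcc hy)
    have h2 : (∫ t in a..x, ‖h t‖) - ∫ t in a..y, ‖h t‖ = ∫ t in y..x, ‖h t‖ :=
      intervalIntegral.integral_interval_sub_left (hsub left_mem_uIcc hx).norm
        (hsub left_mem_uIcc hy).norm
    rw [Real.dist_eq, Real.dist_eq, h2]
    have h3 : ‖W x - W y‖ ≤ |∫ t in y..x, ‖h t‖| := by
      rw [h1]; exact intervalIntegral.norm_integral_le_abs_integral_norm
    have h4 : ‖W x‖ ^ 2 - ‖W y‖ ^ 2 = (‖W x‖ + ‖W y‖) * (‖W x‖ - ‖W y‖) := by ring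
    rw [h4, abs_mul, abs_of_nonneg (by positivity)]
    refine mul_le_mul ?_ ((abs_norm_sub_norm_le _ _).trans h3) (abs_nonneg _) (by positivity)
    linarith [hM x hx, hM y hy]
  have hψ := hi.absolutelyContinuousOnInterval_intervalIntegral (c := a) left_mem_uIcc
  obtain ⟨C, hC⟩ := (hφ.sub hψ).const_of_ae_hasDerivAt_zero (by
    filter_upwards [hh.ae_hasDerivAt_integral, hi.ae_hasDerivAt_integral] with x h1 h2 hx
    have h3 := ((h1 hx a left_mem_uIcc).const_add c).norm_sq
    have h4 := h3.sub (h2 hx a left_mem_uIcc)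
    exact h4.congr_deriv (sub_self _))
  have ha := hC a left_mem_uIcc
  have hb := hC b right_mem_uIcc
  simp only [Pi.sub_apply, intervalIntegral.integral_same, sub_zero] at ha hb
  have hWa : W a = c := by simp [hW]
  rw [hWa] at ha
  linarith

theorem norm_sq_sub_norm_sq_eq {w h : ℝ → E}
    (hint : ∀ T, 0 < T → IntervalIntegrable h volume 0 T)
    (heq : ∀ t, 0 ≤ t → w t = w 0 + ∫ r in (0 : ℝ)..t, h r) {s t : ℝ} (hs : 0 ≤ s) (hst : s ≤ t) :
    IntervalIntegrable (fun r => 2 * inner ℝ (w r) (h r)) volume s t ∧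
    ‖w t‖ ^ 2 - ‖w s‖ ^ 2 = ∫ r in s..t, 2 * inner ℝ (w r) (h r) := by
  have hi {r : ℝ} (hr : 0 ≤ r) : IntervalIntegrable h volume 0 r := by
    rcases hr.eq_or_lt with rfl | hr
    · exact IntervalIntegrable.refl
    · exact hint r hr
  have hw {r : ℝ} (hr : s ≤ r) : w r = w s + ∫ x in s..r, h x := by
    rw [heq r (hs.trans hr), heq s hs, add_assoc,
      intervalIntegral.integral_add_adjacent_intervals (hi hs)
        ((hi hs).symm.trans (hi (hs.trans hr)))]
  have hst' : IntervalIntegrable h volume s t := (hi hs).symm.trans (hi (hs.trans hst))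
  obtain ⟨h1, h2⟩ := norm_sq_primitive_sub hst' (w s)
  rw [← hw hst] at h2
  have hcongr : ∀ r ∈ uIcc s t,
      2 * inner ℝ (w s + ∫ x in s..r, h x) (h r) = 2 * inner ℝ (w r) (h r) := fun r hr => by
    rw [uIcc_of_le hst] at hr
    rw [← hw hr.1]
  refine ⟨h1.congr fun r hr => hcongr r (uIoc_subset_uIcc hr), ?_⟩
  rw [h2]
  exact intervalIntegral.integral_congr hcongr

end Time

/-- **Grönwall's inequality**, for a continuous function with `y' ≤ -a y + ε` in integrated
form. -/
theorem le_of_integral_le_aux {y a : ℝ → ℝ} (hy : Continuous y) (ha : Continuous a) {S ε γ K : ℝ}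
    (hε : 0 < ε) (hγ : 0 < γ) (hyS : 0 ≤ y S)
    (hle : ∀ s t, S ≤ s → s ≤ t → y t - y s ≤ ∫ r in s..t, (-(a r * y r) + ε))
    (hK : ∀ s t, S ≤ s → s ≤ t → γ * (t - s) - K ≤ ∫ r in s..t, a r) {t : ℝ} (ht : S ≤ t) :
    y t ≤ Real.exp (K - γ * (t - S)) * y S + 2 * ε * (Real.exp K / γ) := by
  set A : ℝ → ℝ := fun x => ∫ r in S..x, a r with hA
  have hAd (x : ℝ) : HasDerivAt A (a x) x := ha.integral_hasStrictDerivAt S x |>.hasDerivAt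
  have hAc : Continuous A := continuous_iff_continuousAt.2 fun x => (hAd x).continuousAt
  have hec : Continuous fun r => Real.exp (A r) := Real.continuous_exp.comp hAc
  -- The solution of B' = -aB + 2ε. Doubling ε makes its slope strictly larger than the bound for y
  -- where they meet, as the comparison principle requires.
  set B : ℝ → ℝ := fun x => Real.exp (-A x) * (y S + 2 * ε * ∫ r in S..x, Real.exp (A r)) with hB
  have hBd (x : ℝ) : HasDerivAt B (-(a x * B x) + 2 * ε) x := by
    have h1 := ((hAd x).neg.exp).mul
      (((hec.integral_hasStrictDerivAt S x).hasDerivAt.const_mul (2 * ε)).const_add (y S))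
    refine h1.congr_deriv ?_
    have h2 : Real.exp (-A x) * Real.exp (A x) = 1 := by rw [← Real.exp_add]; simp
    simp only [hB]
    linear_combination (2 * ε) * h2
  have hq : Continuous fun r => -(a r * y r) + ε := by fun_prop
  have hcomp : ∀ x ∈ Icc S t, y x ≤ B x := by
    refine image_le_of_liminf_slope_right_lt_deriv_boundary (f' := fun x => -(a x * y x) + ε)
      hy.continuousOn (fun x hx r hr => ?_) (by simp [hB, hA]) hBd fun x _ hxB => ?_
    · have h1 := (hq.integral_hasStrictDerivAt x x).hasDerivAt.hasDerivWithinAt (s := Ioi x)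
      rw [hasDerivWithinAt_iff_tendsto_slope' (by simp)] at h1
      refine (((h1.eventually (gt_mem_nhds hr)).and self_mem_nhdsWithin).mono ?_).frequently
      rintro z ⟨hz, hxz⟩
      have hxz : x < z := hxz
      refine lt_of_le_of_lt ?_ hz
      rw [slope_def_field, slope_def_field, intervalIntegral.integral_same, sub_zero]
      have := hle x z hx.1 hxz.le
      have : 0 < z - x := sub_pos.2 hxz
      gcongr
    · rw [hxB]; linarith
  refine (hcomp t ⟨ht, le_rfl⟩).trans ?_
  have hsub (r : ℝ) : A t - A r = ∫ x in r..t, a x :=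
    intervalIntegral.integral_interval_sub_left (ha.intervalIntegrable _ _)
      (ha.intervalIntegrable _ _)
  have h1 : Real.exp (-A t) ≤ Real.exp (K - γ * (t - S)) := by
    have := hK S t le_rfl ht
    exact Real.exp_le_exp.2 (by simp only [hA]; linarith)
  have h2 : Real.exp (-A t) * ∫ r in S..t, Real.exp (A r) ≤ Real.exp K / γ := by
    have hd (r : ℝ) : HasDerivAt (fun r => Real.exp (K - γ * (t - r)) / γ)
        (Real.exp (K - γ * (t - r))) r := by
      have := ((((hasDerivAt_id r).const_sub t).const_mul γ).const_sub K).exp.div_const γ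
      refine this.congr_deriv ?_
      field_simp
      simp
    have hcK : Continuous fun r => Real.exp (K - γ * (t - r)) := by fun_prop
    rw [← intervalIntegral.integral_const_mul]
    calc ∫ r in S..t, Real.exp (-A t) * Real.exp (A r)
        ≤ ∫ r in S..t, Real.exp (K - γ * (t - r)) := by
          refine intervalIntegral.integral_mono_on ht ((hec.const_mul _).intervalIntegrable _ _)
            (hcK.intervalIntegrable _ _) fun r hr => ?_
          rw [← Real.exp_add]
          have := hK r t hr.1 hr.2
          rw [← hsub] at this
          exact Real.exp_le_exp.2 (by linarith)
      _ = Real.exp (K - γ * (t - t)) / γ - Real.exp (K - γ * (t - S)) / γ :=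
          intervalIntegral.integral_eq_sub_of_hasDerivAt (fun r _ => hd r)
            (hcK.intervalIntegrable _ _)
      _ ≤ Real.exp K / γ := by
          rw [sub_self, mul_zero, sub_zero]
          have : 0 ≤ Real.exp (K - γ * (t - S)) / γ := by positivity
          linarith
  calc B t = Real.exp (-A t) * y S + 2 * ε * (Real.exp (-A t) * ∫ r in S..t, Real.exp (A r)) := by
        simp only [hB]; ring
    _ ≤ _ := by gcongr

theorem le_of_integral_le {y a : ℝ → ℝ} {S ε γ K : ℝ} (hy : ContinuousOn y (Ici S))
    (ha : ContinuousOn a (Ici S)) (hε : 0 < ε) (hγ : 0 < γ) (hyS : 0 ≤ y S)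
    (hle : ∀ s t, S ≤ s → s ≤ t → y t - y s ≤ ∫ r in s..t, (-(a r * y r) + ε))
    (hK : ∀ s t, S ≤ s → s ≤ t → γ * (t - s) - K ≤ ∫ r in s..t, a r) {t : ℝ} (ht : S ≤ t) :
    y t ≤ Real.exp (K - γ * (t - S)) * y S + 2 * ε * (Real.exp K / γ) := by
  -- Functions are extended to the left of S by their value at S, to have continuity on the whole
  -- line.
  have hext {f : ℝ → ℝ} (hf : ContinuousOn f (Ici S)) : Continuous fun r => f (max S r) :=
    hf.comp_continuous (by fun_prop) fun r => le_max_left S r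
  have hcongr {f g : ℝ → ℝ} (hfg : ∀ r, S ≤ r → f r = g r) {s t : ℝ} (hs : S ≤ s) (hst : s ≤ t) :
      ∫ r in s..t, f r = ∫ r in s..t, g r :=
    intervalIntegral.integral_congr fun r hr => by
      rw [uIcc_of_le hst] at hr
      exact hfg r (hs.trans hr.1)
  have h := le_of_integral_le_aux (hext hy) (hext ha) hε hγ (S := S) (K := K) (by simpa using hyS)
    (fun s t hs hst => by
      rw [max_eq_right hs, max_eq_right (hs.trans hst)]
      refine (hle s t hs hst).trans_eq (hcongr (fun r hr => ?_) hs hst)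
      rw [max_eq_right hr])
    (fun s t hs hst => by
      refine (hK s t hs hst).trans_eq (hcongr (fun r hr => ?_) hs hst)
      rw [max_eq_right hr]) ht
  rwa [max_eq_right ht, max_self] at h

/-- The rate a may change sign: `hK` asks only for a positive long-time average, with the same γ and
K on all intervals. Restarting Grönwall at the time T belonging to ε leaves a residue proportional
to ε. -/
theorem tendsto_zero_of_integral_le {y a : ℝ → ℝ} {γ K : ℝ} (hy : ContinuousOn y (Ici 0))
    (ha : ContinuousOn a (Ici 0)) (hγ : 0 < γ) (hy0 : ∀ t, 0 ≤ y t)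
    (hK : ∀ s t, 0 ≤ s → s ≤ t → γ * (t - s) - K ≤ ∫ r in s..t, a r)
    (hle : ∀ ε, 0 < ε → ∃ T, 0 ≤ T ∧
      ∀ s t, T ≤ s → s ≤ t → y t - y s ≤ ∫ r in s..t, (-(a r * y r) + ε)) :
    Tendsto y atTop (𝓝 0) := by
  rw [Metric.tendsto_atTop']
  intro δ hδ
  -- Chosen so that the residue 2ε e^K/γ equals δ/2.
  set ε := δ / 4 * (γ / Real.exp K) with hε
  have hε0 : 0 < ε := by positivity
  obtain ⟨T, hT, hle⟩ := hle ε hε0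
  have hsub : Ici T ⊆ Ici 0 := Ici_subset_Ici.2 hT
  have hb (t : ℝ) (ht : T ≤ t) := le_of_integral_le (hy.mono hsub) (ha.mono hsub) hε0 hγ (hy0 T) hle
    (fun s t hs hst => hK s t (hT.trans hs) hst) ht
  have he : 2 * ε * (Real.exp K / γ) = δ / 2 := by
    rw [hε]; field_simp; norm_num
  have hlim : Tendsto (fun t => Real.exp (K - γ * (t - T)) * y T) atTop (𝓝 0) := by
    rw [← zero_mul (y T)]
    refine (Real.tendsto_exp_atBot.comp ?_).mul_const _
    simp only [sub_eq_add_neg K]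
    refine tendsto_atBot_add_const_left _ _ (tendsto_neg_atTop_atBot.comp ?_)
    exact (tendsto_atTop_add_const_right _ _ tendsto_id).const_mul_atTop hγ
  obtain ⟨T', hT'⟩ := eventually_atTop.1 (hlim.eventually (gt_mem_nhds (half_pos hδ)))
  refine ⟨max T T', fun t ht => ?_⟩
  rw [Real.dist_eq, sub_zero, abs_of_nonneg (hy0 t)]
  have h1 := hb t ((le_max_left _ _).trans ht.le)
  have h2 := hT' t ((le_max_right _ _).trans ht.le)
  linarith

/-! ## Self-synchronization -/

theorem IsLadyzhenskayaConst.inf {C C' : ℝ} (h : IsLadyzhenskayaConst C)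
    (h' : IsLadyzhenskayaConst C') : IsLadyzhenskayaConst (min C C') := by
  rcases min_choice C C' with h1 | h1 <;> rw [h1] <;> assumption

theorem pairSize_sq (ν : ℝ) (g₁ g₂ : ℝ → VField) :
    pairSize ν g₁ g₂ ^ 2 = forcingSize ν g₁ ^ 2 + forcingSize ν g₂ ^ 2 :=
  Real.sq_sqrt (by positivity)

theorem Nstar_nonneg (C ν μ₁ μ₂ : ℝ) (g₁ g₂ : ℝ → VField) : 0 ≤ Nstar C ν μ₁ μ₂ g₁ g₂ := by
  unfold Nstar pairSize; positivity

theorem Nstar_mono {C C' : ℝ} (h : C ≤ C') (ν μ₁ μ₂ : ℝ) (g₁ g₂ : ℝ → VField) :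
    Nstar C ν μ₁ μ₂ g₁ g₂ ≤ Nstar C' ν μ₁ μ₂ g₁ g₂ := by
  unfold Nstar
  have : 0 ≤ pairSize ν g₁ g₂ := Real.sqrt_nonneg _
  gcongr

theorem Admissible.mono {C C' ν μ₁ μ₂ N : ℝ} {g₁ g₂ : ℝ → VField} (hν : 0 < ν) (h : C ≤ C')
    (hA : Admissible C' ν μ₁ μ₂ N g₁ g₂) : Admissible C ν μ₁ μ₂ N g₁ g₂ where
  N_pos := hA.N_pos
  mu₁_pos := hA.mu₁_pos
  mu₂_pos := hA.mu₂_pos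
  Nstar_le := (Nstar_mono h ν μ₁ μ₂ g₁ g₂).trans hA.Nstar_le
  le_mu := by
    refine le_trans ?_ hA.le_mu
    have := Nstar_mono h ν μ₁ μ₂ g₁ g₂
    have := Nstar_nonneg C ν μ₁ μ₂ g₁ g₂
    gcongr
  mu_le := hA.mu_le

theorem Nstar_sq {C μ₁ μ₂ : ℝ} (hC : 0 ≤ C) (h₁ : 0 < μ₁) (h₂ : 0 < μ₂) (ν : ℝ)
    (g₁ g₂ : ℝ → VField) : Nstar C ν μ₁ μ₂ g₁ g₂ ^ 2 =
      9 / 2 * C * (max μ₁ μ₂ / min μ₁ μ₂) * pairSize ν g₁ g₂ ^ 2 := by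
  have : 0 ≤ max μ₁ μ₂ / min μ₁ μ₂ := by positivity
  unfold Nstar
  rw [mul_pow, mul_pow, mul_pow, div_pow, mul_pow, Real.sq_sqrt hC, Real.sq_sqrt this,
    Real.sq_sqrt zero_le_two]
  ring

/-- With μ₁ = μ₂ the ratio is 1 and N_* no longer depends on μ. Take N = max(N_*, 1), positive even
for zero forcing, and the largest permitted sum μ₁ + μ₂ = (4/3)N²ν. -/
theorem exists_admissible {C ν : ℝ} (hν : 0 < ν) (g₁ g₂ : ℝ → VField) :
    ∃ N μ₁ μ₂ : ℝ, Admissible C ν μ₁ μ₂ N g₁ g₂ := by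
  have h (μ : ℝ) (hμ : 0 < μ) : Nstar C ν μ μ g₁ g₂ = Nstar C ν 1 1 g₁ g₂ := by
    simp only [Nstar, max_self, min_self, div_self hμ.ne', div_self one_ne_zero]
  set n := Nstar C ν 1 1 g₁ g₂ with hn
  have hn0 : 0 ≤ n := Nstar_nonneg C ν 1 1 g₁ g₂
  have hN : 0 < max n 1 := by positivity
  have hμ : 0 < 2 / 3 * max n 1 ^ 2 * ν := by positivity
  refine ⟨max n 1, 2 / 3 * max n 1 ^ 2 * ν, 2 / 3 * max n 1 ^ 2 * ν, hN, hμ, hμ, ?_, ?_, ?_⟩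
  · rw [h _ hμ]; exact le_max_left _ _
  · rw [h _ hμ]
    have : n ^ 2 ≤ max n 1 ^ 2 := by gcongr; exact le_max_left _ _
    nlinarith
  · linarith

theorem IsForcing.norm_le {g : ℝ → VField} (hg : IsForcing g) {ν : ℝ} (hν : 0 < ν) :
    ∀ᵐ t ∂(volume.restrict (Ioi (0 : ℝ))), ‖g t‖ ≤ ν ^ 2 * forcingSize ν g := by
  have h := ae_le_eLpNormEssSup (f := g) (μ := volume.restrict (Ioi (0 : ℝ)))
  rw [← eLpNorm_exponent_top] at h
  filter_upwards [h] with t ht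
  rw [forcingSize, mul_div_cancel₀ _ (by positivity), ← toReal_enorm]
  exact ENNReal.toReal_mono hg.memLp.eLpNorm_ne_top ht

/-- The right-hand side of the Navier–Stokes equation. -/
def velocity (ν : ℝ) (f v : ℝ → VField) (s : ℝ) : VField := f s - ν • stokes (v s) - B (v s) (v s)

theorem inner_velocity {ν : ℝ} {f v : ℝ → VField} {s : ℝ} (h : MemDA (v s)) :
    inner ℝ (v s) (velocity ν f v s) = inner ℝ (f s) (v s) - ν * normV (v s) ^ 2 := by
  rw [velocity, real_inner_comm, inner_sub_left, inner_sub_left, inner_smul_left, h.inner_stokes,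
    inner_B_self h]
  simp

/-! ### Enstrophy averages and decay of the difference -/

section Solution

variable {C ν μ₁ μ₂ N : ℝ} {g₁ g₂ v₁ v₂ : ℝ → VField}

/-- `‖v₁‖² + ‖v₂‖²`. -/
def enstrophy (v₁ v₂ : ℝ → VField) (t : ℝ) : ℝ := normV (v₁ t) ^ 2 + normV (v₂ t) ^ 2

theorem IsStrongSolution.continuousOn_normV_sq {f v : ℝ → VField} (h : IsStrongSolution ν f v) :
    ContinuousOn (fun t => normV (v t) ^ 2) (Ici 0) := by
  simp only [normV_sq]
  exact continuousOn_finsetSum _ fun j _ => (h.continuousOn_pderiv j).norm.pow 2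

theorem IsMutualNudgingSolution.continuousOn_enstrophy
    (h : IsMutualNudgingSolution ν μ₁ μ₂ N g₁ g₂ v₁ v₂) :
    ContinuousOn (enstrophy v₁ v₂) (Ici 0) :=
  h.fst.continuousOn_normV_sq.add h.snd.continuousOn_normV_sq

theorem two_mul_inner_le {ν : ℝ} (hν : 0 < ν) {g v : VField} (hv : MemV v) {G : ℝ} (hG : ‖g‖ ≤ G) :
    2 * inner ℝ g v ≤ G ^ 2 / ν + ν * normV v ^ 2 := by
  have h1 : inner ℝ g v ≤ G * normV v :=
    (real_inner_le_norm g v).trans (mul_le_mul hG hv.norm_le_normV (norm_nonneg _)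
      ((norm_nonneg _).trans hG))
  have h2 : 0 ≤ (G - ν * normV v) ^ 2 / ν := by positivity
  have h3 : (G - ν * normV v) ^ 2 / ν = G ^ 2 / ν - 2 * (G * normV v) + ν * normV v ^ 2 := by
    field_simp; ring
  linarith

theorem ae_restrict_Ioc_of_Ioi {p : ℝ → Prop} {T s t : ℝ} (hs : T ≤ s)
    (h : ∀ᵐ r ∂(volume.restrict (Ioi T)), p r) : ∀ᵐ r ∂(volume.restrict (Ioc s t)), p r :=
  ae_mono (Measure.restrict_mono (fun _ hr => lt_of_le_of_lt hs hr.1) le_rfl) h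

/-- The energy inequality for `μ₂ |v₁|² + μ₁ |v₂|²`. -/
theorem IsMutualNudgingSolution.energy_sub_le (hν : 0 < ν) (h₁ : 0 < μ₁) (h₂ : 0 < μ₂)
    (hg₁ : IsForcing g₁) (hg₂ : IsForcing g₂)
    (h : IsMutualNudgingSolution ν μ₁ μ₂ N g₁ g₂ v₁ v₂) {s t : ℝ} (hs : 0 ≤ s) (hst : s ≤ t) :
    (μ₂ * ‖v₁ t‖ ^ 2 + μ₁ * ‖v₂ t‖ ^ 2) - (μ₂ * ‖v₁ s‖ ^ 2 + μ₁ * ‖v₂ s‖ ^ 2) ≤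
      ∫ r in s..t, (max μ₁ μ₂ * ν ^ 3 * pairSize ν g₁ g₂ ^ 2 -
        ν * (μ₂ * normV (v₁ r) ^ 2 + μ₁ * normV (v₂ r) ^ 2)) := by
  obtain ⟨hi1, he1⟩ := norm_sq_sub_norm_sq_eq h.fst.integrable h.fst.equation hs hst
  obtain ⟨hi2, he2⟩ := norm_sq_sub_norm_sq_eq h.snd.integrable h.snd.equation hs hst
  have hsum : (μ₂ * ‖v₁ t‖ ^ 2 + μ₁ * ‖v₂ t‖ ^ 2) - (μ₂ * ‖v₁ s‖ ^ 2 + μ₁ * ‖v₂ s‖ ^ 2) =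
      μ₂ * (‖v₁ t‖ ^ 2 - ‖v₁ s‖ ^ 2) + μ₁ * (‖v₂ t‖ ^ 2 - ‖v₂ s‖ ^ 2) := by ring
  rw [hsum, he1, he2, ← intervalIntegral.integral_const_mul, ← intervalIntegral.integral_const_mul,
    ← intervalIntegral.integral_add (hi1.const_mul _) (hi2.const_mul _)]
  have hsub : uIcc s t ⊆ Ici 0 := fun r hr => by
    rw [uIcc_of_le hst] at hr; exact hs.trans hr.1
  refine intervalIntegral.integral_mono_ae_restrict hst
    ((hi1.const_mul _).add (hi2.const_mul _)) ?_ ?_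
  · refine ContinuousOn.intervalIntegrable (ContinuousOn.mono ?_ hsub)
    exact continuousOn_const.sub (continuousOn_const.mul ((continuousOn_const.mul
      h.fst.continuousOn_normV_sq).add (continuousOn_const.mul h.snd.continuousOn_normV_sq)))
  refine ae_mono (Measure.restrict_mono_ae Ioc_ae_eq_Icc.symm.le) ?_
  filter_upwards [ae_restrict_Ioc_of_Ioi hs h.fst.memDA, ae_restrict_Ioc_of_Ioi hs h.snd.memDA,
    ae_restrict_Ioc_of_Ioi hs (hg₁.norm_le hν), ae_restrict_Ioc_of_Ioi hs (hg₂.norm_le hν)]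
    with r hd1 hd2 hn1 hn2
  have e1 := inner_velocity (ν := ν)
    (f := fun t => g₁ t + μ₁ • (lowModes N (v₂ t) - lowModes N (v₁ t))) hd1
  have e2 := inner_velocity (ν := ν)
    (f := fun t => g₂ t + μ₂ • (lowModes N (v₁ t) - lowModes N (v₂ t))) hd2
  simp only [velocity] at e1 e2
  rw [e1, e2]
  simp only [inner_add_left, inner_smul_left, RCLike.conj_to_real]
  have b1 := two_mul_inner_le hν hd1.memV hn1
  have b2 := two_mul_inner_le hν hd2.memV hn2
  -- With weights μ₂ and μ₁ both nudging terms carry the factor μ₁μ₂, and their sum is -2μ₁μ₂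
  -- (P_N(v₁ - v₂), v₁ - v₂), which can be dropped.
  have b3 := inner_lowModes_nonneg N (v₁ r - v₂ r)
  rw [lowModes_sub, inner_sub_right] at b3
  have b3' : inner ℝ (lowModes N (v₂ r) - lowModes N (v₁ r)) (v₁ r) =
      -inner ℝ (lowModes N (v₁ r) - lowModes N (v₂ r)) (v₁ r) := by
    rw [← inner_neg_left, neg_sub]
  rw [b3']
  set P₁ : ℝ := inner ℝ (lowModes N (v₁ r) - lowModes N (v₂ r)) (v₁ r)
  set P₂ : ℝ := inner ℝ (lowModes N (v₁ r) - lowModes N (v₂ r)) (v₂ r)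
  have c1 := mul_le_mul_of_nonneg_left b1 h₂.le
  have c2 := mul_le_mul_of_nonneg_left b2 h₁.le
  have c3 := mul_nonneg (mul_pos h₁ h₂).le b3
  have d1 : (ν ^ 2 * forcingSize ν g₁) ^ 2 / ν = ν ^ 3 * forcingSize ν g₁ ^ 2 := by
    field_simp
  have d2 : (ν ^ 2 * forcingSize ν g₂) ^ 2 / ν = ν ^ 3 * forcingSize ν g₂ ^ 2 := by
    field_simp
  rw [d1] at c1
  rw [d2] at c2
  have c4 : μ₂ * (ν ^ 3 * forcingSize ν g₁ ^ 2) ≤ max μ₁ μ₂ * (ν ^ 3 * forcingSize ν g₁ ^ 2) := by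
    gcongr; exact le_max_right _ _
  have c5 : μ₁ * (ν ^ 3 * forcingSize ν g₂ ^ 2) ≤ max μ₁ μ₂ * (ν ^ 3 * forcingSize ν g₂ ^ 2) := by
    gcongr; exact le_max_left _ _
  rw [pairSize_sq]
  linarith

theorem IsMutualNudgingSolution.exists_integral_enstrophy_le (hν : 0 < ν) (h₁ : 0 < μ₁)
    (h₂ : 0 < μ₂) (hg₁ : IsForcing g₁) (hg₂ : IsForcing g₂)
    (h : IsMutualNudgingSolution ν μ₁ μ₂ N g₁ g₂ v₁ v₂) :
    ∃ K, ∀ s t, 0 ≤ s → s ≤ t → ∫ r in s..t, enstrophy v₁ v₂ r ≤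
      max μ₁ μ₂ / min μ₁ μ₂ * ν ^ 2 * pairSize ν g₁ g₂ ^ 2 * (t - s) + K := by
  set R := max μ₁ μ₂ * ν ^ 3 * pairSize ν g₁ g₂ ^ 2 with hR
  set F : ℝ → ℝ := fun t => μ₂ * ‖v₁ t‖ ^ 2 + μ₁ * ‖v₂ t‖ ^ 2 with hF
  have hR0 : 0 ≤ R := by positivity
  have hF0 (t : ℝ) : 0 ≤ F t := by positivity
  have hFc : ContinuousOn F (Ici 0) :=
    (continuousOn_const.mul (h.fst.continuousOn.norm.pow 2)).add
      (continuousOn_const.mul (h.snd.continuousOn.norm.pow 2))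
  have hint {q : ℝ → ℝ} (hq : ContinuousOn q (Ici 0)) {s t : ℝ} (hs : 0 ≤ s) (hst : s ≤ t) :
      IntervalIntegrable q volume s t :=
    ContinuousOn.intervalIntegrable (hq.mono fun r hr => by
      rw [uIcc_of_le hst] at hr; exact hs.trans hr.1)
  have hDc : ContinuousOn (fun r => R - ν * (μ₂ * normV (v₁ r) ^ 2 + μ₁ * normV (v₂ r) ^ 2))
      (Ici 0) :=
    continuousOn_const.sub (continuousOn_const.mul ((continuousOn_const.mul
      h.fst.continuousOn_normV_sq).add (continuousOn_const.mul h.snd.continuousOn_normV_sq)))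
  -- Poincaré turns the energy inequality into F' ≤ -νF + R. The value ε = R + 1 keeps ε positive
  -- when R = 0.
  have hb : ∀ t, 0 ≤ t → F t ≤ F 0 + 2 * (R + 1) * (1 / ν) := fun t ht => by
    have := le_of_integral_le (y := F) (a := fun _ => ν) (S := 0) (ε := R + 1) (γ := ν) (K := 0)
      hFc continuousOn_const (by positivity) hν (hF0 0) (fun s t hs hst => by
        refine (h.energy_sub_le hν h₁ h₂ hg₁ hg₂ hs hst).trans ?_
        refine intervalIntegral.integral_mono_on hst (hint hDc hs hst)
          (hint ((continuousOn_const.mul hFc).neg.add continuousOn_const) hs hst) fun r hr => ?_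
        have hr0 := hs.trans hr.1
        have e1 : ‖v₁ r‖ ^ 2 ≤ normV (v₁ r) ^ 2 := by
          gcongr; exact (h.fst.memV r hr0).norm_le_normV
        have e2 : ‖v₂ r‖ ^ 2 ≤ normV (v₂ r) ^ 2 := by
          gcongr; exact (h.snd.memV r hr0).norm_le_normV
        have e3 : ν * F r ≤ ν * (μ₂ * normV (v₁ r) ^ 2 + μ₁ * normV (v₂ r) ^ 2) := by
          simp only [hF]; gcongr
        linarith)
      (fun s t _ _ => by simp [mul_comm]) ht
    refine this.trans ?_
    rw [Real.exp_zero]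
    have : Real.exp (0 - ν * (t - 0)) * F 0 ≤ 1 * F 0 := by
      refine mul_le_mul_of_nonneg_right ?_ (hF0 0)
      rw [Real.exp_le_one_iff]
      have := mul_nonneg hν.le ht
      linarith
    linarith
  have hm : 0 < min μ₁ μ₂ := lt_min h₁ h₂
  -- The error comes from the term F s, bounded uniformly in s by `hb`; it depends on the initial
  -- data but not on s or t.
  refine ⟨(F 0 + 2 * (R + 1) * (1 / ν)) / (ν * min μ₁ μ₂), fun s t hs hst => ?_⟩
  have h3 : F t - F s ≤ ∫ r in s..t, (R - ν * min μ₁ μ₂ * enstrophy v₁ v₂ r) := by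
    refine (h.energy_sub_le hν h₁ h₂ hg₁ hg₂ hs hst).trans ?_
    refine intervalIntegral.integral_mono_on hst (hint hDc hs hst)
      (hint (continuousOn_const.sub (continuousOn_const.mul h.continuousOn_enstrophy)) hs hst)
      fun r _ => ?_
    have e1 : min μ₁ μ₂ * normV (v₁ r) ^ 2 ≤ μ₂ * normV (v₁ r) ^ 2 := by
      gcongr; exact min_le_right _ _
    have e2 : min μ₁ μ₂ * normV (v₂ r) ^ 2 ≤ μ₁ * normV (v₂ r) ^ 2 := by
      gcongr; exact min_le_left _ _
    have e3 := mul_le_mul_of_nonneg_left (add_le_add e1 e2) hν.le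
    simp only [enstrophy]
    linarith
  rw [intervalIntegral.integral_sub (hint continuousOn_const hs hst)
    ((hint h.continuousOn_enstrophy hs hst).const_mul _), intervalIntegral.integral_const,
    intervalIntegral.integral_const_mul, smul_eq_mul] at h3
  have h4 := hb s hs
  have h5 := hF0 t
  have h6 : max μ₁ μ₂ / min μ₁ μ₂ * ν ^ 2 * pairSize ν g₁ g₂ ^ 2 * (t - s) +
      (F 0 + 2 * (R + 1) * (1 / ν)) / (ν * min μ₁ μ₂) =
      ((t - s) * R + (F 0 + 2 * (R + 1) * (1 / ν))) / (ν * min μ₁ μ₂) := by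
    rw [add_div, hR]
    field_simp
  rw [h6, le_div_iff₀ (by positivity)]
  linarith

/-- The pointwise-in-time estimate for the difference `w` of the two solutions. -/
theorem inner_difference_le (hC : IsLadyzhenskayaConst C) (hν : 0 < ν) {μ : ℝ} (hμ : 0 < μ)
    (hN : 0 < N) (hμN : μ ≤ 4 / 3 * N ^ 2 * ν) {g w v : VField} (hw : MemV w) :
    2 * (inner ℝ g w - μ * inner ℝ (lowModes N w) w - ν * normV w ^ 2 - trilinear w v w) ≤
      -((5 / 8 * μ - C ^ 2 / ν * normV v ^ 2) * ‖w‖ ^ 2) + 8 / μ * ‖g‖ ^ 2 := by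
  have h1 : 2 * inner ℝ g w ≤ μ / 8 * ‖w‖ ^ 2 + 8 / μ * ‖g‖ ^ 2 := by
    have e1 := real_inner_le_norm g w
    have e2 : 0 ≤ (μ / 8 * ‖w‖ - ‖g‖) ^ 2 * (8 / μ) := by positivity
    have e3 : (μ / 8 * ‖w‖ - ‖g‖) ^ 2 * (8 / μ) =
        μ / 8 * ‖w‖ ^ 2 - 2 * (‖g‖ * ‖w‖) + 8 / μ * ‖g‖ ^ 2 := by
      field_simp; ring
    linarith
  set P : ℝ := inner ℝ (lowModes N w) w with hP
  have hP0 : 0 ≤ P := inner_lowModes_nonneg N w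
  have hP1 : 0 ≤ ‖w‖ ^ 2 - P := by
    have := (real_inner_le_norm (lowModes N w) w).trans
      (mul_le_mul_of_nonneg_right (norm_lowModes_le N w) (norm_nonneg w))
    rw [sq]; linarith
  have h2 : μ * (‖w‖ ^ 2 - P) ≤ 4 / 3 * ν * normV w ^ 2 := by
    have e1 := mul_le_mul_of_nonneg_right hμN hP1
    have e2 := mul_le_mul_of_nonneg_left (hw.sq_mul_le_normV_sq hN.le) hν.le
    linarith
  -- Half of the dissipation 2ν‖w‖² covers the high modes and gives the rate 3μ/4; the other half
  -- absorbs the trilinear term. The forcing costs μ/8, which leaves 5μ/8.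
  have h3 : 3 / 4 * μ * ‖w‖ ^ 2 - ν * normV w ^ 2 ≤ 2 * (μ * P) := by
    have := mul_nonneg hμ.le hP0
    linarith
  have h4 : -(2 * trilinear w v w) ≤ ν * normV w ^ 2 + C ^ 2 / ν * normV v ^ 2 * ‖w‖ ^ 2 := by
    have e1 := (neg_le_abs _).trans (abs_trilinear_self_le hC hw v)
    have e2 : 0 ≤ (ν * normV w - C * normV v * ‖w‖) ^ 2 / ν := by positivity
    have e3 : (ν * normV w - C * normV v * ‖w‖) ^ 2 / ν = ν * normV w ^ 2 -
        2 * (C * (normV w * ‖w‖) * normV v) + C ^ 2 / ν * normV v ^ 2 * ‖w‖ ^ 2 := by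
      field_simp; ring
    linarith
  linarith

theorem isSelfSynchronous_of_admissible (hC : IsLadyzhenskayaConst C) (hC' : C ≤ 11 / 5)
    (hν : 0 < ν) (hg₁ : IsForcing g₁) (hg₂ : IsForcing g₂)
    (hA : Admissible C ν μ₁ μ₂ N g₁ g₂) : IsSelfSynchronous ν μ₁ μ₂ N g₁ g₂ := by
  intro hg v₁ v₂ h
  have h₁ := hA.mu₁_pos
  have h₂ := hA.mu₂_pos
  set μ := μ₁ + μ₂ with hμ
  have hμ0 : 0 < μ := add_pos h₁ h₂
  set w : ℝ → VField := fun t => v₁ t - v₂ t with hw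
  set a : ℝ → ℝ := fun t => 5 / 8 * μ - C ^ 2 / ν * enstrophy v₁ v₂ t with ha
  have hac : ContinuousOn a (Ici 0) :=
    continuousOn_const.sub (continuousOn_const.mul h.continuousOn_enstrophy)
  have hwc : ContinuousOn (fun t => ‖w t‖ ^ 2) (Ici 0) :=
    (h.fst.continuousOn.sub h.snd.continuousOn).norm.pow 2
  have hsub {s t : ℝ} (hs : 0 ≤ s) (hst : s ≤ t) : uIcc s t ⊆ Ici 0 := fun r hr => by
    rw [uIcc_of_le hst] at hr; exact hs.trans hr.1
  obtain ⟨K, hK⟩ := h.exists_integral_enstrophy_le hν h₁ h₂ hg₁ hg₂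
  -- Here C ≤ 11/5 is essential: the lower bound on μ gives CX ≤ μ/6, so C²X ≤ 11μ/30 < 3μ/8. The
  -- averaged rate is then at least 5μ/8 - 3μ/8 = μ/4.
  have hsmall : C ^ 2 / ν * (max μ₁ μ₂ / min μ₁ μ₂ * ν ^ 2 * pairSize ν g₁ g₂ ^ 2) ≤ 3 / 8 * μ := by
    have e1 := hA.le_mu
    rw [Nstar_sq hC.1.le h₁ h₂] at e1
    have hm : 0 < min μ₁ μ₂ := lt_min h₁ h₂
    set X := max μ₁ μ₂ / min μ₁ μ₂ * pairSize ν g₁ g₂ ^ 2 * ν with hX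
    have hX0 : 0 ≤ X := by positivity
    have e2 : C ^ 2 / ν * (max μ₁ μ₂ / min μ₁ μ₂ * ν ^ 2 * pairSize ν g₁ g₂ ^ 2) = C * (C * X) := by
      rw [hX]; field_simp
    have e3 : 6 * (C * X) ≤ μ := by rw [hX, hμ]; linarith
    have e4 : C * (C * X) ≤ 11 / 5 * (C * X) :=
      mul_le_mul_of_nonneg_right hC' (mul_nonneg hC.1.le hX0)
    rw [e2]; linarith
  have hlim : Tendsto (fun t => ‖w t‖ ^ 2) atTop (𝓝 0) := by
    refine tendsto_zero_of_integral_le (a := a) (γ := μ / 4) (K := C ^ 2 / ν * K) hwc hac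
      (by positivity) (fun t => by positivity) (fun s t hs hst => ?_) fun ε hε => ?_
    · have hi : IntervalIntegrable (enstrophy v₁ v₂) volume s t :=
        (h.continuousOn_enstrophy.mono (hsub hs hst)).intervalIntegrable
      simp only [ha]
      rw [intervalIntegral.integral_sub intervalIntegrable_const (hi.const_mul _),
        intervalIntegral.integral_const, intervalIntegral.integral_const_mul, smul_eq_mul]
      have e1 := mul_le_mul_of_nonneg_left (hK s t hs hst) (by positivity : 0 ≤ C ^ 2 / ν)
      have e2 := mul_le_mul_of_nonneg_right hsmall (sub_nonneg.2 hst)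
      linarith
    · have hev : ∀ᶠ t in atTop ⊓ ae volume, 8 / μ * ‖g₁ t - g₂ t‖ ^ 2 < ε := by
        have := (hg.pow 2).const_mul (8 / μ)
        simp only [ne_eq, OfNat.ofNat_ne_zero, not_false_eq_true, zero_pow, mul_zero] at this
        exact this.eventually (gt_mem_nhds hε)
      -- The forcing difference is small for large times outside a null set, which suffices because
      -- it is used only under an integral.
      obtain ⟨S, hS, A, hAe, hSA⟩ := eventually_inf.1 hev
      obtain ⟨T, hT⟩ := mem_atTop_sets.1 hS
      refine ⟨max T 0, le_max_right _ _, fun s t hs hst => ?_⟩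
      have hs0 : 0 ≤ s := (le_max_right _ _).trans hs
      have hi (r : ℝ) (hr : 0 < r) := (h.fst.integrable r hr).sub (h.snd.integrable r hr)
      have he (r : ℝ) (hr : 0 ≤ r) : w r = w 0 + ∫ x in (0 : ℝ)..r,
          (velocity ν (fun t => g₁ t + μ₁ • (lowModes N (v₂ t) - lowModes N (v₁ t))) v₁ x -
            velocity ν (fun t => g₂ t + μ₂ • (lowModes N (v₁ t) - lowModes N (v₂ t))) v₂ x) := by
        rcases hr.eq_or_lt with rfl | hr
        · simp
        · unfold velocity
          rw [intervalIntegral.integral_sub (h.fst.integrable r hr) (h.snd.integrable r hr)]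
          simp only [hw]
          rw [h.fst.equation r hr.le, h.snd.equation r hr.le]
          abel
      obtain ⟨hi', he'⟩ := norm_sq_sub_norm_sq_eq hi he hs0 hst
      rw [he']
      refine intervalIntegral.integral_mono_ae_restrict hst hi' ?_ ?_
      · exact ContinuousOn.intervalIntegrable
          (((hac.mul hwc).neg.add continuousOn_const).mono (hsub hs0 hst))
      refine ae_mono (Measure.restrict_mono_ae Ioc_ae_eq_Icc.symm.le) ?_
      filter_upwards [ae_restrict_Ioc_of_Ioi hs0 h.fst.memDA,
        ae_restrict_Ioc_of_Ioi hs0 h.snd.memDA, ae_restrict_of_ae hAe,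
        ae_restrict_mem measurableSet_Ioc] with r hd1 hd2 hrA hr
      have hsmall' := hSA r ⟨hT r ((le_max_left _ _).trans (hs.trans hr.1.le)), hrA⟩
      have hwV : MemV (w r) := hd1.memV.sub hd2.memV
      have hB := inner_B_sub_B hd1 hd2
      have hSt := (hd1.sub hd2).inner_stokes
      rw [hd1.stokes_sub hd2] at hSt
      have hv : velocity ν (fun t => g₁ t + μ₁ • (lowModes N (v₂ t) - lowModes N (v₁ t))) v₁ r -
          velocity ν (fun t => g₂ t + μ₂ • (lowModes N (v₁ t) - lowModes N (v₂ t))) v₂ r =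
          (g₁ r - g₂ r) - μ • lowModes N (w r) - ν • (stokes (v₁ r) - stokes (v₂ r)) -
            (B (v₁ r) (v₁ r) - B (v₂ r) (v₂ r)) := by
        simp only [velocity, hw, lowModes_sub, hμ, smul_sub, add_smul]
        abel
      have hinner : 2 * inner ℝ (w r)
          (velocity ν (fun t => g₁ t + μ₁ • (lowModes N (v₂ t) - lowModes N (v₁ t))) v₁ r -
            velocity ν (fun t => g₂ t + μ₂ • (lowModes N (v₁ t) - lowModes N (v₂ t))) v₂ r) =
          2 * (inner ℝ (g₁ r - g₂ r) (w r) - μ * inner ℝ (lowModes N (w r)) (w r) -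
            ν * normV (w r) ^ 2 - trilinear (w r) (v₂ r) (w r)) := by
        rw [hv, real_inner_comm, inner_sub_left, inner_sub_left, inner_sub_left,
          inner_smul_left, inner_smul_left, hSt, hB]
        rfl
      refine hinner.le.trans
        ((inner_difference_le hC hν hμ0 hA.N_pos hA.mu_le hwV (v := v₂ r)).trans ?_)
      have hens : normV (v₂ r) ^ 2 ≤ enstrophy v₁ v₂ r := by
        have := sq_nonneg (normV (v₁ r))
        simp only [enstrophy]; linarith
      have h5 : (5 / 8 * μ - C ^ 2 / ν * enstrophy v₁ v₂ r) * ‖w r‖ ^ 2 ≤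
          (5 / 8 * μ - C ^ 2 / ν * normV (v₂ r) ^ 2) * ‖w r‖ ^ 2 := by
        gcongr
      simp only [ha]
      linarith
  have := (Real.continuous_sqrt.tendsto _).comp hlim
  simpa [Function.comp_def, Real.sqrt_sq] using this

end Solution

end

end NSE

/-! ### The theorem -/

theorem mainTheorem6 :
    (∃ C_L : ℝ, NSE.IsLadyzhenskayaConst C_L) ∧
    ∀ C_L : ℝ, NSE.IsLadyzhenskayaConst C_L →
      ∀ ν : ℝ, 0 < ν →
      ∀ g₁ g₂ : ℝ → NSE.VField, NSE.IsForcing g₁ → NSE.IsForcing g₂ →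
        (∃ N μ₁ μ₂ : ℝ, NSE.Admissible C_L ν μ₁ μ₂ N g₁ g₂ ∧
          NSE.IsSelfSynchronous ν μ₁ μ₂ N g₁ g₂) ∧
        (∀ N μ₁ μ₂ : ℝ, NSE.Admissible C_L ν μ₁ μ₂ N g₁ g₂ →
          NSE.IsSelfSynchronous ν μ₁ μ₂ N g₁ g₂) := by
  refine ⟨⟨_, NSE.isLadyzhenskayaConst⟩, fun C hC ν hν g₁ g₂ hg₁ hg₂ => ?_⟩
  -- Self-synchrony does not mention C, so C may be replaced by min(C, 11/5), for which the
  -- parameters remain admissible.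
  have key : ∀ N μ₁ μ₂ : ℝ, NSE.Admissible C ν μ₁ μ₂ N g₁ g₂ →
      NSE.IsSelfSynchronous ν μ₁ μ₂ N g₁ g₂ := fun N μ₁ μ₂ hA =>
    NSE.isSelfSynchronous_of_admissible (hC.inf NSE.isLadyzhenskayaConst) (min_le_right _ _) hν
      hg₁ hg₂ (hA.mono hν (min_le_left _ _))
  obtain ⟨N, μ₁, μ₂, hA⟩ := NSE.exists_admissible (C := C) hν g₁ g₂
  exact ⟨⟨N, μ₁, μ₂, hA, key N μ₁ μ₂ hA⟩, key⟩
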